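/- Let $G$ be a finite simple connected graph with $N_0\ge 2$ vertices and $E_0$ edges, and let $n\ge 2$ be even. Let $\tau_n(G)$ be the $n$-polygon graph of $G$, obtained from $G$ by adding, for every edge $ij$ of $G$, a new path of length $n$ (with $n-1$ new inner vertices) joining $i$ and $j$, the edge $ij$ being kept. For a graph $H$ without isolated vertices let $\mathcal L_H=D^{-1/2}(D-A)D^{-1/2}$ be its normalized Laplacian ($A$ the adjacency matrix, $D$ the diagonal matrix of degrees), and let $m_{\mathcal L_H}(\mu)$ be the multiplicity of $\mu\in\mathbb R$ as an eigenvalue of $\mathcal L_H$ ($0$ if $\mu$ is not an eigenvalue). Define $a_{-1}(\mu)=0$, $a_0(\mu)=1$ and $a_k(\mu)=2(1-\mu)a_{k-1}(\mu)-a_{k-2}(\mu)$ for $k\ge 1$. Then: (i) $m_{\mathcal L_{\tau_n(G)}}(0)=1$. (ii) If $a_{n/2}(\mu)+a_{n/2-1}(\mu)=0$, then $m_{\mathcal L_{\tau_n(G)}}(\mu)=N_0$. (iii) If $a_{n/2-1}(\mu)=0$, then $m_{\mathcal L_{\tau_n(G)}}(\mu)=E_0-N_0+1$. (iv) If $G$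 is non-bipartite and $a_{n/2}(\mu)-a_{n/2-2}(\mu)=0$, then $m_{\mathcal L_{\tau_n(G)}}(\mu)=E_0-N_0$. (v) If $G$ is bipartite and $a_{n/2}(\mu)-a_{n/2-2}(\mu)=0$, then $m_{\mathcal L_{\tau_n(G)}}(\mu)=E_0-N_0+1$. (vi) Let $\lambda\ne 0,2$ be an eigenvalue of $\mathcal L_G$. Then the equation $$1-\frac{a_{n/2}(x)-a_{n/2-1}(x)}{a_{n/2-1}(x)-a_{n/2-2}(x)}=\lambda$$ has exactly $n/2$ distinct real roots $\mu_1(\lambda),\dots,\mu_{n/2}(\lambda)$ (the denominator being nonzero at each), and each of them is an eigenvalue of $\mathcal L_{\tau_n(G)}$ with $m_{\mathcal L_{\tau_n(G)}}(\mu_i(\lambda))=m_{\mathcal L_G}(\lambda)$. Moreover, every eigenvalue of $\mathcal L_{\tau_n(G)}$ is $0$, or a root of one of the equations in (ii)--(v), or one of the $\mu_i(\lambda)$ in (vi), so that the spectrum of $\mathcal L_{\tau_n(G)}$ is completely described. -/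

import Mathlib

noncomputable section

/-- Auxiliary sequence: `polySeqAux μ k` is the term of index `k - 1` of the sequence below. -/
def polySeqAux (μ : ℝ) : ℕ → ℝ
  | 0 => 0
  | 1 => 1
  | k + 2 => 2 * (1 - μ) * polySeqAux μ (k + 1) - polySeqAux μ k

/-- The sequence `a_k(μ)`, `k ≥ -1`: `a_{-1}(μ) = 0`, `a_0(μ) = 1` and
`a_k(μ) = 2 (1 - μ) a_{k-1}(μ) - a_{k-2}(μ)` for `k ≥ 1`. (It is not used for `k < -1`.) -/
def polySeq (k : ℤ) (μ : ℝ) : ℝ := polySeqAux μ (k + 1).toNat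

theorem polySeq_neg_one (μ : ℝ) : polySeq (-1) μ = 0 := by
  simp [polySeq, polySeqAux]

theorem polySeq_zero (μ : ℝ) : polySeq 0 μ = 1 := by
  simp [polySeq, polySeqAux]

theorem polySeq_rec (μ : ℝ) (k : ℤ) (hk : 1 ≤ k) :
    polySeq k μ = 2 * (1 - μ) * polySeq (k - 1) μ - polySeq (k - 2) μ := by
  obtain ⟨m, rfl⟩ : ∃ m : ℕ, k = (m : ℤ) + 1 := ⟨(k - 1).toNat, by omega⟩
  have h1 : ((m : ℤ) + 1 + 1).toNat = m + 2 := by omega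
  have h2 : ((m : ℤ) + 1 - 1 + 1).toNat = m + 1 := by omega
  have h3 : ((m : ℤ) + 1 - 2 + 1).toNat = m := by omega
  simp only [polySeq, h1, h2, h3, polySeqAux]

namespace SimpleGraph

/-- The normalized Laplacian `D^{-1/2} (D - A) D^{-1/2}` of a finite graph. -/
def normLap {V : Type*} [Fintype V] [DecidableEq V] (G : SimpleGraph V) [DecidableRel G.Adj] :
    Matrix V V ℝ :=
  Matrix.diagonal (fun v => (Real.sqrt (G.degree v))⁻¹) * G.lapMatrix ℝ *
    Matrix.diagonal (fun v => (Real.sqrt (G.degree v))⁻¹)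

/-- The eigenvalues of the normalized Laplacian. -/
def IsNormLapEigenvalue {V : Type*} [Fintype V] [DecidableEq V] (G : SimpleGraph V)
    [DecidableRel G.Adj] (μ : ℝ) : Prop :=
  Module.End.HasEigenvalue (Matrix.toLin' G.normLap) μ

/-- The multiplicity of `μ` as an eigenvalue of the normalized Laplacian: the dimension of its
eigenspace, so `0` if `μ` is not an eigenvalue. (The matrix is real and symmetric, so this is also
the algebraic multiplicity.) -/
def normLapMult {V : Type*} [Fintype V] [DecidableEq V] (G : SimpleGraph V)
    [DecidableRel G.Adj] (μ : ℝ) : ℕ :=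
  Module.finrank ℝ (Module.End.eigenspace (Matrix.toLin' G.normLap) μ)

/-- One end of an edge, by an arbitrary choice. -/
def edgeSrc {V : Type*} (G : SimpleGraph V) (e : G.edgeSet) : V := (Quot.out (e : Sym2 V)).1

/-- The other end of the edge. -/
def edgeTgt {V : Type*} (G : SimpleGraph V) (e : G.edgeSet) : V := (Quot.out (e : Sym2 V)).2

theorem mk_edgeSrc_edgeTgt {V : Type*} (G : SimpleGraph V) (e : G.edgeSet) :
    s(G.edgeSrc e, G.edgeTgt e) = (e : Sym2 V) :=
  Quot.out_eq (e : Sym2 V)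

/-- Adjacency in the `n`-polygon graph. The vertices are the old vertices and, for every edge `e`,
the `n - 1` inner vertices `(e, 0), …, (e, n - 2)` of a new path of length `n` between the ends
of `e`. Old adjacencies are kept. -/
def PolygonAdj {V : Type*} (G : SimpleGraph V) (n : ℕ) :
    V ⊕ (G.edgeSet × Fin (n - 1)) → V ⊕ (G.edgeSet × Fin (n - 1)) → Prop
  | .inl u, .inl v => G.Adj u v
  | .inl u, .inr (e, k) =>
      (u = G.edgeSrc e ∧ (k : ℕ) = 0) ∨ (u = G.edgeTgt e ∧ (k : ℕ) + 2 = n)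
  | .inr (e, k), .inl u =>
      (u = G.edgeSrc e ∧ (k : ℕ) = 0) ∨ (u = G.edgeTgt e ∧ (k : ℕ) + 2 = n)
  | .inr (e, k), .inr (f, l) => e = f ∧ ((k : ℕ) + 1 = l ∨ (l : ℕ) + 1 = k)

/-- The `n`-polygon graph `τ_n(G)` (for `n ≥ 2`): to every edge of `G` a path of length `n`
joining the ends of the edge is added. -/
def polygonGraph {V : Type*} (G : SimpleGraph V) (n : ℕ) :
    SimpleGraph (V ⊕ (G.edgeSet × Fin (n - 1))) where
  Adj := G.PolygonAdj n
  symm := ⟨by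
    rintro (u | ⟨e, k⟩) (v | ⟨f, l⟩) h
    · exact SimpleGraph.Adj.symm (G := G) h
    · exact h
    · exact h
    · exact ⟨h.1.symm, h.2.symm⟩⟩
  loopless := ⟨by
    rintro (u | ⟨e, k⟩) h
    · exact G.irrefl h
    · simp [PolygonAdj] at h⟩

instance {V : Type*} (G : SimpleGraph V) (n : ℕ) : DecidableRel (G.polygonGraph n).Adj :=
  Classical.decRel _

end SimpleGraph

end

/-! Write `S k` for `polySeqAux μ k`, the Chebyshev value `U_{k-1}(1 - μ)`. Rescaling by square
roots of degrees turns an eigenvector of the normalized Laplacian into a function `g` with `(1 - μ)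
d(v) g(v) = ∑_{u ∼ v} g(u)`. Inner path vertices have degree 2, so along a new path `g` obeys the
recursion of `S`: it is determined by its values `h` on old vertices and `x` at the first inner
vertices. What remains is one matching condition per edge, with coefficients `S n` and `S (n - 1)`,
and one equation per old vertex, whose degree has doubled.

If `S n ≠ 0`, the matching condition determines `x` from `h`, and by the Cassini identity the vertex
equations become `S (n + 1) d(v) h(v) = (S n + 1) ∑_{u ∼ v} h(u)`
(`finrank_polygonData_of_ne_zero`). With `m = n / 2`, both coefficients contain the factor `a_m +
a_{m-1}`. If it vanishes, `h` is arbitrary, with multiplicity `N_0`. Otherwise it cancels and `h` is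
a walk eigenfunction on `G` with `1 - λ = (a_m - a_{m-1}) / (a_{m-1} - a_{m-2})`.

If `S n = a_{m-1} (a_m - a_{m-2})` vanishes, then `S (n - 1) = -s` with `s = ±1`. Pairing the vertex
equations with `h` forces `h = 0`, and `x` ranges over the kernel of an incidence matrix with sign
`s`, whose dimension follows from rank-nullity (`finrank_polygonData_of_eq_zero`): `s = 1` gives the
cycle space, and for `s = -1` bipartiteness matters.

For `0 < λ < 2` the `m` roots are found by interlacing with Chebyshev nodes
(`ncard_polySeqAux_roots`). -/

/-! ### Identities for the Chebyshev sequence -/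

theorem polySeqAux_add_two (μ : ℝ) (k : ℕ) :
    polySeqAux μ (k + 2) = 2 * (1 - μ) * polySeqAux μ (k + 1) - polySeqAux μ k := by
  rw [polySeqAux]

/-- The Chebyshev addition formula; the induction moves one step from `j` to `k`. Taken near the
diagonal it halves the index `n`. -/
theorem polySeqAux_add (μ : ℝ) (j k : ℕ) :
    polySeqAux μ (j + k + 1) =
      polySeqAux μ (j + 1) * polySeqAux μ (k + 1) - polySeqAux μ j * polySeqAux μ k := by
  induction j generalizing k with
  | zero => simp [polySeqAux]
  | succ j ih =>
    have h := ih (k + 1)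
    rw [show j + (k + 1) + 1 = j + 1 + k + 1 by ring] at h
    rw [h, polySeqAux_add_two μ j, polySeqAux_add_two μ k]
    ring

/-- The Cassini identity for the sequence. -/
theorem polySeqAux_cassini (μ : ℝ) (k : ℕ) :
    polySeqAux μ (k + 1) ^ 2 - polySeqAux μ (k + 2) * polySeqAux μ k = 1 := by
  induction k with
  | zero => simp [polySeqAux]
  | succ k ih =>
    have h := polySeqAux_add_two μ k
    rw [show k + 1 + 2 = k + 3 by ring, show k + 1 + 1 = k + 2 by ring,
      polySeqAux_add_two μ (k + 1), show k + 1 + 1 = k + 2 by ring]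
    linear_combination ih + (polySeqAux μ (k + 2)) * h

section DoubleIndex

variable (μ : ℝ) (t : ℕ)

theorem polySeqAux_two_mul :
    polySeqAux μ (2 * t + 2) =
      polySeqAux μ (t + 1) * (polySeqAux μ (t + 2) - polySeqAux μ t) := by
  have h := polySeqAux_add μ t (t + 1)
  rw [show t + (t + 1) + 1 = 2 * t + 2 by ring] at h
  rw [h]
  ring

theorem polySeqAux_two_mul_add_one :
    polySeqAux μ (2 * t + 1) = polySeqAux μ (t + 1) ^ 2 - polySeqAux μ t ^ 2 := by
  have h := polySeqAux_add μ t t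
  rw [show t + t + 1 = 2 * t + 1 by ring] at h
  rw [h]
  ring

theorem polySeqAux_two_mul_add_three :
    polySeqAux μ (2 * t + 3) =
      (polySeqAux μ (t + 2) + polySeqAux μ (t + 1)) *
        (polySeqAux μ (t + 2) - polySeqAux μ (t + 1)) := by
  have h := polySeqAux_two_mul_add_one μ (t + 1)
  rw [show 2 * (t + 1) + 1 = 2 * t + 3 by ring] at h
  rw [h]
  ring

/-- The added `1` is the Cassini expression. The first factor is shared with
`polySeqAux_two_mul_add_three`, which is what singles out the roots of `a_m + a_{m-1}`. -/
theorem polySeqAux_two_mul_add_one_eq_mul :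
    polySeqAux μ (2 * t + 2) + 1 =
      (polySeqAux μ (t + 2) + polySeqAux μ (t + 1)) *
        (polySeqAux μ (t + 1) - polySeqAux μ t) := by
  have h := polySeqAux_cassini μ t
  rw [polySeqAux_two_mul]
  linear_combination -h

end DoubleIndex

theorem polySeqAux_at_zero (k : ℕ) : polySeqAux 0 k = k := by
  induction k using Nat.twoStepInduction with
  | zero => simp [polySeqAux]
  | one => simp [polySeqAux]
  | more k h1 h2 => rw [polySeqAux_add_two, h1, h2]; push_cast; ring

theorem polySeqAux_at_two (k : ℕ) : polySeqAux 2 k = -(-1) ^ k * k := by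
  induction k using Nat.twoStepInduction with
  | zero => simp [polySeqAux]
  | one => simp [polySeqAux]
  | more k h1 h2 => rw [polySeqAux_add_two, h1, h2]; push_cast; ring

/-- For `μ ≤ 0` the coefficient `2 (1 - μ)` is at least `2`, so the increments never decrease. -/
theorem polySeqAux_pos_of_nonpos {μ : ℝ} (hμ : μ ≤ 0) (k : ℕ) :
    0 ≤ polySeqAux μ k ∧ polySeqAux μ k + 1 ≤ polySeqAux μ (k + 1) := by
  induction k with
  | zero => simp [polySeqAux]
  | succ k ih =>
    refine ⟨by linarith, ?_⟩
    rw [polySeqAux_add_two]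
    nlinarith

/-- The values `1 - μ = ±1` mean `μ = 0` or `μ = 2`, where the sequence is `±k`. -/
theorem ne_of_polySeqAux_eq_zero {μ s : ℝ} {k : ℕ} (hk : k ≠ 0) (h : polySeqAux μ k = 0)
    (hs : s ^ 2 = 1) : 1 - μ ≠ s := by
  have hk' : (k : ℝ) ≠ 0 := Nat.cast_ne_zero.2 hk
  rintro rfl
  have h' : μ * (μ - 2) = 0 := by linear_combination hs
  rcases mul_eq_zero.1 h' with rfl | h'
  · rw [polySeqAux_at_zero] at h
    exact hk' h
  · obtain rfl : μ = 2 := by linarith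
    rw [polySeqAux_at_two] at h
    simp [hk'] at h

/-! ### Counting the real roots -/

theorem polySeqAux_mul_sin (θ : ℝ) (k : ℕ) :
    polySeqAux (1 - Real.cos θ) k * Real.sin θ = Real.sin (k * θ) := by
  induction k using Nat.twoStepInduction with
  | zero => simp [polySeqAux]
  | one => simp [polySeqAux]
  | more k h1 h2 =>
    have e1 : ((k + 2 : ℕ) : ℝ) * θ = (k + 1 : ℕ) * θ + θ := by push_cast; ring
    have e2 : (k : ℝ) * θ = (k + 1 : ℕ) * θ - θ := by push_cast; ring
    rw [e1, Real.sin_add, polySeqAux_add_two, sub_mul, h1, mul_assoc, h2, e2, Real.sin_sub]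
    ring

theorem exists_polynomial_eval_eq_polySeqAux (k : ℕ) :
    ∃ P : Polynomial ℝ, P.natDegree ≤ k - 1 ∧ ∀ x, P.eval x = polySeqAux x k := by
  induction k using Nat.twoStepInduction with
  | zero => exact ⟨0, by simp, by simp [polySeqAux]⟩
  | one => exact ⟨1, by simp, by simp [polySeqAux]⟩
  | more k h1 h2 =>
    obtain ⟨P, hP, hP'⟩ := h1
    obtain ⟨Q, hQ, hQ'⟩ := h2
    refine ⟨Polynomial.C 2 * (1 - Polynomial.X) * Q - P, ?_, fun x => ?_⟩
    · refine (Polynomial.natDegree_sub_le _ _).trans (max_le ?_ (by omega))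
      refine Polynomial.natDegree_mul_le.trans ?_
      have : (Polynomial.C (2 : ℝ) * (1 - Polynomial.X)).natDegree ≤ 1 := by
        compute_degree
      omega
    · simp [polySeqAux_add_two, hP', hQ']

/-- The equation `a_m - a_{m-1} = r (a_{m-1} - a_{m-2})` has exactly `m` real roots
when `|r| < 1`. -/
theorem ncard_polySeqAux_roots {r : ℝ} (hr : |r| < 1) (t : ℕ) :
    {x : ℝ | polySeqAux x (t + 2) - polySeqAux x (t + 1) =
      r * (polySeqAux x (t + 1) - polySeqAux x t)}.ncard = t + 1 := by
  obtain ⟨hr1, hr2⟩ := abs_lt.1 hr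
  obtain ⟨P, hP, hP'⟩ := exists_polynomial_eval_eq_polySeqAux (t + 2)
  obtain ⟨Q, hQ, hQ'⟩ := exists_polynomial_eval_eq_polySeqAux (t + 1)
  obtain ⟨R, hR, hR'⟩ := exists_polynomial_eval_eq_polySeqAux t
  set F : Polynomial ℝ := P - Q - Polynomial.C r * (Q - R) with hF
  have hFe : ∀ x, F.eval x = polySeqAux x (t + 2) - polySeqAux x (t + 1) -
      r * (polySeqAux x (t + 1) - polySeqAux x t) := by
    intro x
    simp [hF, hP', hQ', hR']
  have hdeg : F.natDegree ≤ t + 1 := by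
    refine (Polynomial.natDegree_sub_le _ _).trans (max_le ?_ ?_)
    · refine (Polynomial.natDegree_sub_le _ _).trans (max_le ?_ ?_) <;> omega
    · refine (Polynomial.natDegree_C_mul_le _ _).trans ?_
      refine (Polynomial.natDegree_sub_le _ _).trans (max_le ?_ ?_) <;> omega
  have hF0 : F ≠ 0 := by
    intro h
    have := hFe 0
    rw [h] at this
    simp only [Polynomial.eval_zero, polySeqAux_at_zero] at this
    push_cast at this
    linarith
  have hset : {x : ℝ | polySeqAux x (t + 2) - polySeqAux x (t + 1) =
      r * (polySeqAux x (t + 1) - polySeqAux x t)} = (F.roots.toFinset : Set ℝ) := by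
    ext x
    simp [hF0, hFe, sub_eq_zero]
  rw [hset, Set.ncard_coe_finset]
  apply le_antisymm
  · exact (Multiset.toFinset_card_le _).trans ((Polynomial.card_roots' F).trans hdeg)
  -- The points `1 - cos (jπ / (t + 1))` increase from `0` to `2`, and the inner ones are zeros of
  -- `a_t`. The sign of `F` alternates along these `t + 2` points, which yields `t + 1` roots.
  set θ : ℕ → ℝ := fun j => j * Real.pi / (t + 1 : ℝ) with hθ
  have ht : (0 : ℝ) < t + 1 := by positivity
  have hθmono : StrictMono θ := by
    refine strictMono_nat_of_lt_succ fun j => ?_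
    simp only [hθ]
    gcongr
    simp
  have hθlast : θ (t + 1) = Real.pi := by
    simp only [hθ]
    push_cast
    field_simp
  have hθzero : θ 0 = 0 := by simp [hθ]
  set z : ℕ → ℝ := fun j => 1 - Real.cos (θ j) with hz
  have hzlt : ∀ {i j : ℕ}, i < j → j ≤ t + 1 → z i < z j := by
    intro i j hij hj
    have := Real.cos_lt_cos_of_nonneg_of_le_pi (hθzero ▸ hθmono.monotone (Nat.zero_le i))
      (hθlast ▸ hθmono.monotone hj) (hθmono hij)
    simp only [hz]
    linarith
  have hsign : ∀ j ≤ t + 1, 0 < (-1) ^ j * F.eval (z j) := by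
    intro j hj
    rw [hFe]
    rcases Nat.eq_zero_or_pos j with rfl | hj0
    · have : z 0 = 0 := by simp [hz, hθzero]
      rw [this]
      simp only [polySeqAux_at_zero]
      push_cast
      linarith
    rcases hj.eq_or_lt with rfl | hjt
    · have : z (t + 1) = 2 := by simp [hz, hθlast]; norm_num
      rw [this]
      simp only [polySeqAux_at_two]
      have h1 : ((-1 : ℝ) ^ t) * (-1) ^ t = 1 := by
        rw [← mul_pow]; simp
      push_cast
      have : (-1 : ℝ) ^ (t + 1) * (-(-1) ^ (t + 2) * (t + 2) - -(-1) ^ (t + 1) * (t + 1) -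
          r * (-(-1) ^ (t + 1) * (t + 1) - -(-1) ^ t * t)) =
          ((-1) ^ t * (-1) ^ t) * ((t + 2) + (t + 1) + r * ((t + 1) + t)) := by ring
      rw [this, h1]
      nlinarith
    · have hpos : 0 < Real.sin (θ j) :=
        Real.sin_pos_of_pos_of_lt_pi (hθzero ▸ hθmono hj0) (hθlast ▸ hθmono hjt)
      have hmul : ((t + 1 : ℕ) : ℝ) * θ j = j * Real.pi := by
        simp only [hθ]
        push_cast
        field_simp
      -- The three values computed here give `F (z j) = (-1) ^ j * (1 - r)`.
      have h1 : polySeqAux (z j) (t + 1) = 0 := by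
        have := polySeqAux_mul_sin (θ j) (t + 1)
        rw [hmul, Real.sin_nat_mul_pi] at this
        exact (mul_eq_zero.1 this).resolve_right hpos.ne'
      have h2 : polySeqAux (z j) (t + 2) = (-1) ^ j := by
        have := polySeqAux_mul_sin (θ j) (t + 2)
        rw [show ((t + 2 : ℕ) : ℝ) * θ j = j * Real.pi + θ j by rw [← hmul]; push_cast; ring,
          Real.sin_add, Real.sin_nat_mul_pi, Real.cos_nat_mul_pi, zero_mul, zero_add] at this
        exact mul_right_cancel₀ hpos.ne' this
      have h3 : polySeqAux (z j) t = -(-1) ^ j := by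
        have := polySeqAux_add_two (z j) t
        rw [h1, h2] at this
        linarith
      have h4 : (-1 : ℝ) ^ j * (-1) ^ j = 1 := by rw [← mul_pow]; simp
      rw [h1, h2, h3]
      nlinarith
  have hroot : ∀ j : Fin (t + 1), ∃ x ∈ Set.Ioo (z j) (z (j + 1)), F.eval x = 0 := by
    intro j
    have h1 := hsign j (by omega)
    have h2 := hsign (j + 1) (by omega)
    have hle : z j ≤ z (j + 1) := (hzlt (Nat.lt_succ_self _) (by omega)).le
    have hc : ContinuousOn (fun x => (-1) ^ (j : ℕ) * F.eval x) (Set.Icc (z j) (z (j + 1))) := by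
      fun_prop
    obtain ⟨x, hx, hx'⟩ := intermediate_value_Ioo' hle hc
      (show (0 : ℝ) ∈ _ from ⟨by rw [pow_succ] at h2; linarith, h1⟩)
    exact ⟨x, hx, by simpa using hx'⟩
  choose x hx hx0 using hroot
  have hxmono : StrictMono x := by
    intro i j hij
    have : z (i + 1) ≤ z j := by
      rcases (Nat.succ_le_of_lt hij).eq_or_lt with h | h
      · exact le_of_eq (congrArg z h)
      · exact (hzlt h (by omega)).le
    exact (hx i).2.trans (this.trans_lt (hx j).1)
  have hcard : (Finset.univ.image x).card = t + 1 := by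
    rw [Finset.card_image_of_injective _ hxmono.injective, Finset.card_univ, Fintype.card_fin]
  rw [← hcard]
  refine Finset.card_le_card fun y hy => ?_
  obtain ⟨j, -, rfl⟩ := Finset.mem_image.1 hy
  simp [hF0, hx0]
-- Walk eigenspaces and functions twisted along edges
namespace SimpleGraph

variable {V : Type*}

/-- The eigenspace of the simple random walk operator on `G` for the eigenvalue `1 - μ`. -/
def walkEigenspace [Fintype V] (G : SimpleGraph V) [DecidableRel G.Adj] (μ : ℝ) : Submodule ℝ (V → ℝ) where
  carrier := {g | ∀ v, (1 - μ) * G.degree v * g v = ∑ u ∈ G.neighborFinset v, g u}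
  add_mem' := by
    intro f g hf hg v
    simp only [Pi.add_apply, Finset.sum_add_distrib, ← hf v, ← hg v]
    ring
  zero_mem' := by simp
  smul_mem' := by
    intro a g hg v
    simp only [Pi.smul_apply, smul_eq_mul, ← Finset.mul_sum, ← hg v]
    ring

theorem mem_walkEigenspace [Fintype V] {G : SimpleGraph V} [DecidableRel G.Adj] {μ : ℝ} {g : V → ℝ} :
    g ∈ G.walkEigenspace μ ↔
      ∀ v, (1 - μ) * G.degree v * g v = ∑ u ∈ G.neighborFinset v, g u := Iff.rfl

theorem normLap_mulVec_apply [Fintype V] [DecidableEq V] (G : SimpleGraph V) [DecidableRel G.Adj] (f : V → ℝ) (v : V) :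
    (G.normLap.mulVec f) v = (Real.sqrt (G.degree v))⁻¹ *
      (G.degree v * ((Real.sqrt (G.degree v))⁻¹ * f v) -
        ∑ u ∈ G.neighborFinset v, (Real.sqrt (G.degree u))⁻¹ * f u) := by
  rw [normLap, ← Matrix.mulVec_mulVec, ← Matrix.mulVec_mulVec, Matrix.mulVec_diagonal,
    lapMatrix_mulVec_apply]
  simp [Matrix.mulVec_diagonal]

/-- Rescaling by the square roots of the degrees identifies the eigenspaces of the normalized
Laplacian with those of the random walk. -/
noncomputable def eigenspaceEquivWalkEigenspace [Fintype V] [DecidableEq V] (G : SimpleGraph V) [DecidableRel G.Adj]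
    (hdeg : ∀ v, 0 < G.degree v) (μ : ℝ) :
    Module.End.eigenspace (Matrix.toLin' G.normLap) μ ≃ₗ[ℝ] G.walkEigenspace μ := by
  have hs : ∀ v, Real.sqrt (G.degree v) ≠ 0 := fun v =>
    (Real.sqrt_pos.2 (Nat.cast_pos.2 (hdeg v))).ne'
  refine LinearEquiv.ofSubmodules
    (LinearEquiv.piCongrRight fun v => LinearEquiv.smulOfNeZero ℝ ℝ _ (inv_ne_zero (hs v))) _ _ ?_
  ext g
  rw [Submodule.mem_map_equiv, Module.End.mem_eigenspace_iff, mem_walkEigenspace, funext_iff]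
  refine forall_congr' fun v => ?_
  have hsq : Real.sqrt (G.degree v) * Real.sqrt (G.degree v) = G.degree v :=
    Real.mul_self_sqrt (Nat.cast_nonneg _)
  have hsymm : ∀ u, ((LinearEquiv.piCongrRight fun v =>
      LinearEquiv.smulOfNeZero ℝ ℝ _ (inv_ne_zero (hs v))).symm g) u =
      Real.sqrt (G.degree u) * g u := by
    intro u
    rw [LinearEquiv.piCongrRight_symm, LinearEquiv.piCongrRight_apply,
      LinearEquiv.symm_apply_eq]
    simp [hs u]
  rw [Matrix.toLin'_apply, normLap_mulVec_apply, Pi.smul_apply]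
  simp only [hsymm, inv_mul_cancel_left₀ (hs _), smul_eq_mul]
  rw [inv_mul_eq_iff_eq_mul₀ (hs v)]
  have : Real.sqrt (G.degree v) * (μ * (Real.sqrt (G.degree v) * g v)) =
      μ * (Real.sqrt (G.degree v) * Real.sqrt (G.degree v)) * g v := by ring
  rw [this, hsq]
  constructor <;> intro h <;> linarith

theorem normLapMult_eq_finrank [Fintype V] [DecidableEq V] (G : SimpleGraph V) [DecidableRel G.Adj]
    (hdeg : ∀ v, 0 < G.degree v) (μ : ℝ) :
    G.normLapMult μ = Module.finrank ℝ (G.walkEigenspace μ) :=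
  (G.eigenspaceEquivWalkEigenspace hdeg μ).finrank_eq

theorem isNormLapEigenvalue_iff_normLapMult_pos [Fintype V] [DecidableEq V] (G : SimpleGraph V) [DecidableRel G.Adj]
    (μ : ℝ) : G.IsNormLapEigenvalue μ ↔ 0 < G.normLapMult μ := by
  rw [IsNormLapEigenvalue, normLapMult, Module.End.hasEigenvalue_iff, Module.finrank_pos_iff,
    Submodule.nontrivial_iff_ne_bot]

/-- Functions on the vertices which are multiplied by `s` along each edge. -/
def edgeTwistSpace (G : SimpleGraph V) (s : ℝ) : Submodule ℝ (V → ℝ) where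
  carrier := {h | ∀ e : G.edgeSet, h (G.edgeSrc e) = s * h (G.edgeTgt e)}
  add_mem' := by
    intro f g hf hg e
    simp only [Pi.add_apply, hf e, hg e]
    ring
  zero_mem' := by simp
  smul_mem' := by
    intro a g hg e
    simp only [Pi.smul_apply, smul_eq_mul, hg e]
    ring

theorem adj_edgeSrc_edgeTgt (G : SimpleGraph V) (e : G.edgeSet) :
    G.Adj (G.edgeSrc e) (G.edgeTgt e) := by
  have := e.2
  rwa [← G.mk_edgeSrc_edgeTgt e, mem_edgeSet] at this

/-- Since `s` is its own inverse, the condition does not depend on the chosen orientation of the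
edges. -/
theorem mem_edgeTwistSpace_iff {G : SimpleGraph V} {s : ℝ} (hs : s ^ 2 = 1) {h : V → ℝ} :
    h ∈ G.edgeTwistSpace s ↔ ∀ u v, G.Adj u v → h u = s * h v := by
  refine ⟨fun H u v huv => ?_, fun H e => H _ _ (G.adj_edgeSrc_edgeTgt e)⟩
  have he := H ⟨s(u, v), huv⟩
  have := G.mk_edgeSrc_edgeTgt ⟨s(u, v), huv⟩
  simp only [Sym2.eq_iff] at this
  rcases this with ⟨h1, h2⟩ | ⟨h1, h2⟩
  · rwa [h1, h2] at he
  · rw [h1, h2] at he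
    rw [he]
    linear_combination (-h u) * hs

theorem mem_edgeTwistSpace_one_iff {G : SimpleGraph V} (hG : G.Connected) {h : V → ℝ} :
    h ∈ G.edgeTwistSpace 1 ↔ ∃ a : ℝ, h = fun _ => a := by
  rw [mem_edgeTwistSpace_iff (by norm_num)]
  constructor
  · intro H
    obtain ⟨v₀⟩ := hG.nonempty
    refine ⟨h v₀, funext fun v => ?_⟩
    obtain ⟨w⟩ := hG.preconnected v v₀
    induction w with
    | nil => rfl
    | cons hadj _ ih => rw [H _ _ hadj, one_mul, ih]
  · rintro ⟨a, rfl⟩ u v -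
    simp

theorem finrank_edgeTwistSpace_one {G : SimpleGraph V} (hG : G.Connected) :
    Module.finrank ℝ (G.edgeTwistSpace 1) = 1 := by
  have : G.edgeTwistSpace 1 = Submodule.span ℝ {fun _ => (1 : ℝ)} := by
    ext h
    rw [mem_edgeTwistSpace_one_iff hG, Submodule.mem_span_singleton]
    refine exists_congr fun a => ?_
    rw [eq_comm]
    simp [Pi.smul_def]
  rw [this]
  refine finrank_span_singleton fun h => ?_
  obtain ⟨v⟩ := hG.nonempty
  simpa using congrFun h v

/-- Multiplication by the sign of a 2-colouring exchanges the twists `1` and `-1`. -/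
theorem finrank_edgeTwistSpace_neg_one_of_isBipartite {G : SimpleGraph V} (hG : G.Connected)
    (hb : G.IsBipartite) : Module.finrank ℝ (G.edgeTwistSpace (-1)) = 1 := by
  obtain ⟨C⟩ := hb
  set σ : V → ℝ := fun v => if C v = 0 then 1 else -1 with hσ
  have hσ0 : ∀ v, σ v ≠ 0 := fun v => by simp only [hσ]; split_ifs <;> norm_num
  have hσadj : ∀ u v, G.Adj u v → σ u = -σ v := by
    intro u v huv
    have := C.valid huv
    simp only [hσ]
    split_ifs with h1 h2 h2
    · exact absurd (h1.trans h2.symm) this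
    · norm_num
    · norm_num
    · omega
  rw [← finrank_edgeTwistSpace_one hG]
  refine LinearEquiv.finrank_eq (LinearEquiv.ofSubmodules
    (LinearEquiv.piCongrRight fun v => LinearEquiv.smulOfNeZero ℝ ℝ _ (hσ0 v)) _ _ ?_)
  ext g
  rw [Submodule.mem_map_equiv, mem_edgeTwistSpace_iff (by norm_num),
    mem_edgeTwistSpace_iff (by norm_num)]
  have hsymm : ∀ u, ((LinearEquiv.piCongrRight fun v =>
      LinearEquiv.smulOfNeZero ℝ ℝ _ (hσ0 v)).symm g) u = (σ u)⁻¹ * g u := by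
    intro u
    rw [LinearEquiv.piCongrRight_symm, LinearEquiv.piCongrRight_apply,
      LinearEquiv.symm_apply_eq]
    simp [hσ0 u]
  refine forall_congr' fun u => forall_congr' fun v => forall_congr' fun huv => ?_
  rw [hsymm, hsymm, hσadj u v huv, inv_neg, neg_mul, neg_one_mul, neg_inj, one_mul,
    mul_right_inj' (inv_ne_zero (hσ0 v))]

/-- The square of such a function is constant by connectedness, so a nonzero one vanishes nowhere
and its sign is a 2-colouring. -/
theorem finrank_edgeTwistSpace_neg_one_of_not_isBipartite {G : SimpleGraph V} (hG : G.Connected)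
    (hb : ¬ G.IsBipartite) : Module.finrank ℝ (G.edgeTwistSpace (-1)) = 0 := by
  suffices G.edgeTwistSpace (-1) = ⊥ by rw [this, finrank_bot]
  rw [Submodule.eq_bot_iff]
  intro h hh
  rw [mem_edgeTwistSpace_iff (by norm_num)] at hh
  have hc : (fun v => h v ^ 2) ∈ G.edgeTwistSpace 1 := by
    rw [mem_edgeTwistSpace_iff (by norm_num)]
    intro u v huv
    simp only [hh u v huv]
    ring
  obtain ⟨a, ha⟩ := (mem_edgeTwistSpace_one_iff hG).1 hc
  by_contra h0
  apply hb
  obtain ⟨w, hw⟩ := Function.ne_iff.1 h0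
  have hne : ∀ v, h v ≠ 0 := by
    intro v hv
    have h1 := congrFun ha v
    have h2 := congrFun ha w
    simp only [hv] at h1
    apply hw
    have : h w ^ 2 = 0 := by linarith
    simpa using this
  refine ⟨Coloring.mk (fun v => if 0 < h v then 0 else 1) ?_⟩
  intro u v huv
  have h1 := hh u v huv
  have h2 := hne u
  rcases lt_or_gt_of_ne (hne v) with h3 | h3
  · have : 0 < h u := by linarith
    simp [this, h3.le]
  · have : h u ≤ 0 := by linarith
    simp [this, h3]

theorem walkEigenspace_zero [Fintype V] [DecidableEq V] (G : SimpleGraph V) [DecidableRel G.Adj] :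
    G.walkEigenspace 0 = G.edgeTwistSpace 1 := by
  ext h
  rw [mem_edgeTwistSpace_iff (by norm_num), mem_walkEigenspace]
  simp only [one_mul, sub_zero]
  rw [← lapMatrix_mulVec_eq_zero_iff_forall_adj, funext_iff]
  refine forall_congr' fun v => ?_
  rw [lapMatrix_mulVec_apply, Pi.zero_apply, sub_eq_zero]

theorem sum_neighborFinset_comm [Fintype V] (G : SimpleGraph V) [DecidableRel G.Adj] (f : V → V → ℝ) :
    ∑ v, ∑ u ∈ G.neighborFinset v, f v u = ∑ v, ∑ u ∈ G.neighborFinset v, f u v :=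
  Finset.sum_comm' (by simp [adj_comm])

/-- The eigenvalues of the normalized Laplacian lie in `[0, 2]`. -/
theorem IsNormLapEigenvalue.abs_one_sub_le [Fintype V] [DecidableEq V] {G : SimpleGraph V} [DecidableRel G.Adj]
    (hdeg : ∀ v, 0 < G.degree v) {l : ℝ} (hl : G.IsNormLapEigenvalue l) : |1 - l| ≤ 1 := by
  rw [isNormLapEigenvalue_iff_normLapMult_pos, normLapMult_eq_finrank G hdeg,
    Module.finrank_pos_iff, Submodule.nontrivial_iff_ne_bot] at hl
  obtain ⟨h, hh, h0⟩ := Submodule.exists_mem_ne_zero_of_ne_bot hl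
  set S : ℝ := ∑ v, G.degree v * h v ^ 2 with hS
  have e1 : ∑ v, ∑ u ∈ G.neighborFinset v, h v ^ 2 = S := by
    simp [hS]
  have e2 : ∑ v, ∑ u ∈ G.neighborFinset v, h u ^ 2 = S := by
    rw [← e1, G.sum_neighborFinset_comm fun v u => h v ^ 2]
  have e3 : ∑ v, ∑ u ∈ G.neighborFinset v, h v * h u = (1 - l) * S := by
    rw [hS, Finset.mul_sum]
    refine Finset.sum_congr rfl fun v _ => ?_
    rw [← Finset.mul_sum, ← hh v]
    ring
  have hpos : 0 < S := by
    obtain ⟨w, hw⟩ := Function.ne_iff.1 h0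
    refine Finset.sum_pos' (fun v _ => by positivity) ⟨w, Finset.mem_univ _, ?_⟩
    have h1 : (0 : ℝ) < G.degree w := Nat.cast_pos.2 (hdeg w)
    have h2 : 0 < h w ^ 2 := by
      have : h w ≠ 0 := hw
      positivity
    positivity
  -- The right side is the sum of `(h v + s * h u) ^ 2` over ordered adjacent pairs; `s = 1` and `s
  -- = -1` give the two bounds.
  have key : ∀ s : ℝ, s ^ 2 = 1 → 0 ≤ 2 * S + 2 * s * ((1 - l) * S) := by
    intro s hs
    have : ∑ v, ∑ u ∈ G.neighborFinset v, (h v + s * h u) ^ 2 =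
        2 * S + 2 * s * ((1 - l) * S) := by
      have hexp : ∀ v u, (h v + s * h u) ^ 2 = h v ^ 2 + h u ^ 2 + 2 * s * (h v * h u) := by
        intro v u
        linear_combination h u ^ 2 * hs
      simp only [hexp, Finset.sum_add_distrib, ← Finset.mul_sum] at e3 ⊢
      simp only [Finset.mul_sum] at e3 ⊢
      simp only [e1, e2, ← e3, Finset.mul_sum]
      ring
    rw [← this]
    positivity
  have h1 := key 1 (by norm_num)
  have h2 := key (-1) (by norm_num)
  rw [abs_le]
  constructor <;> nlinarith

end SimpleGraph

/-! ### Neighbour sums and degrees in the polygon graph -/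

set_option linter.unusedSectionVars false

namespace SimpleGraph

theorem edgeSrc_ne_edgeTgt {V : Type*} (G : SimpleGraph V) (e : G.edgeSet) :
    G.edgeSrc e ≠ G.edgeTgt e :=
  (G.adj_edgeSrc_edgeTgt e).ne

variable {V : Type*} [Fintype V] [DecidableEq V]

/-- Each edge at `v` has `v` as exactly one of its two ends, so the oriented edge sum runs once
through the neighbours. This removes the arbitrary orientation from the vertex equations. -/
theorem sum_edges_eq_sum_neighborFinset (G : SimpleGraph V) [DecidableRel G.Adj]
    (f : V → V → ℝ) (v : V) :
    ∑ e : G.edgeSet, ((if v = G.edgeSrc e then f (G.edgeSrc e) (G.edgeTgt e) else 0) +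
      (if v = G.edgeTgt e then f (G.edgeTgt e) (G.edgeSrc e) else 0)) =
      ∑ u ∈ G.neighborFinset v, f v u := by
  have h1 : ∀ u ∈ G.neighborFinset v, f v u =
      ∑ e : G.edgeSet, if s(v, u) = (e : Sym2 V) then f v u else 0 := by
    intro u hu
    rw [mem_neighborFinset] at hu
    rw [Finset.sum_eq_single (⟨s(v, u), hu⟩ : G.edgeSet)]
    · simp
    · intro e _ he
      rw [if_neg]
      rintro h
      exact he (Subtype.ext h.symm)
    · simp
  rw [Finset.sum_congr rfl h1, Finset.sum_comm]
  refine Finset.sum_congr rfl fun e _ => ?_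
  have hne := G.edgeSrc_ne_edgeTgt e
  have hadj := G.adj_edgeSrc_edgeTgt e
  rw [← G.mk_edgeSrc_edgeTgt e]
  simp only [Sym2.eq_iff]
  by_cases h1 : v = G.edgeSrc e
  · have h2 : v ≠ G.edgeTgt e := h1 ▸ hne
    rw [if_pos h1, if_neg h2, add_zero, Finset.sum_eq_single (G.edgeTgt e)]
    · simp [h1]
    · intro u _ hu
      simp [h2, hu]
    · intro h
      exact absurd (by simpa [h1] using hadj) h
  · by_cases h2 : v = G.edgeTgt e
    · rw [if_neg h1, if_pos h2, zero_add, Finset.sum_eq_single (G.edgeSrc e)]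
      · simp [h2]
      · intro u _ hu
        simp [h1, hu]
      · intro h
        exact absurd (by simpa [h2] using hadj.symm) h
    · simp [h1, h2]

theorem sum_sum_neighborFinset_eq_sum_edges (G : SimpleGraph V) [DecidableRel G.Adj]
    (f : V → V → ℝ) :
    ∑ v, ∑ u ∈ G.neighborFinset v, f v u =
      ∑ e : G.edgeSet, (f (G.edgeSrc e) (G.edgeTgt e) + f (G.edgeTgt e) (G.edgeSrc e)) := by
  simp only [← sum_edges_eq_sum_neighborFinset]
  rw [Finset.sum_comm]
  simp [Finset.sum_add_distrib]

theorem sum_neighborFinset_eq_sum_ite (G : SimpleGraph V) [DecidableRel G.Adj] (v : V)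
    (g : V → ℝ) : ∑ u ∈ G.neighborFinset v, g u = ∑ u, if G.Adj v u then g u else 0 := by
  rw [neighborFinset_eq_filter, Finset.sum_filter]

/-- The value of `g` at the vertex of index `i` on the path of length `n` attached to the edge
`e`. -/
noncomputable def pathValue (G : SimpleGraph V) {n : ℕ} (g : V ⊕ (G.edgeSet × Fin (n - 1)) → ℝ)
    (e : G.edgeSet) (i : ℕ) : ℝ :=
  if i = 0 then g (.inl (G.edgeSrc e))
  else if h : i - 1 < n - 1 then g (.inr (e, ⟨i - 1, h⟩)) else g (.inl (G.edgeTgt e))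

theorem _root_.Fin.sum_ite_val_eq {N : ℕ} (j : ℕ) (f : Fin N → ℝ) :
    (∑ l : Fin N, if (l : ℕ) = j then f l else 0) = if h : j < N then f ⟨j, h⟩ else 0 := by
  split_ifs with h
  · rw [Finset.sum_eq_single ⟨j, h⟩]
    · simp
    · intro l _ hl
      rw [if_neg]
      rintro rfl
      exact hl rfl
    · simp
  · refine Finset.sum_eq_zero fun l _ => if_neg ?_
    rintro rfl
    exact h l.2

theorem ite_or_eq_add {p q : Prop} [Decidable p] [Decidable q] [Decidable (p ∨ q)]
    (hpq : ¬ (p ∧ q)) (a : ℝ) :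
    (if p ∨ q then a else 0) = (if p then a else 0) + (if q then a else 0) := by
  by_cases hp : p <;> by_cases hq : q <;> simp_all

variable (G : SimpleGraph V) [DecidableRel G.Adj] (k : ℕ)

theorem polygonGraph_sum_neighborFinset_inl (g : V ⊕ (G.edgeSet × Fin (k + 1)) → ℝ) (v : V) :
    ∑ w ∈ (G.polygonGraph (k + 2)).neighborFinset (.inl v), g w =
      ∑ u ∈ G.neighborFinset v, g (.inl u) +
      ∑ e : G.edgeSet, ((if v = G.edgeSrc e then g (.inr (e, 0)) else 0) +
        (if v = G.edgeTgt e then g (.inr (e, Fin.last k)) else 0)) := by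
  classical
  rw [sum_neighborFinset_eq_sum_ite, sum_neighborFinset_eq_sum_ite, Fintype.sum_sum_type]
  congr 1
  · exact Finset.sum_congr rfl fun u _ => if_congr Iff.rfl rfl rfl
  · rw [Fintype.sum_prod_type]
    refine Finset.sum_congr rfl fun e _ => ?_
    have hne := G.edgeSrc_ne_edgeTgt e
    have hval : ∀ l : Fin (k + 2 - 1), (if (G.polygonGraph (k + 2)).Adj (.inl v) (.inr (e, l))
        then g (.inr (e, l)) else 0) =
        (if v = G.edgeSrc e then (if (l : ℕ) = 0 then g (.inr (e, l)) else 0) else 0) +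
        (if v = G.edgeTgt e then (if (l : ℕ) = k then g (.inr (e, l)) else 0) else 0) := by
      intro l
      have : (G.polygonGraph (k + 2)).Adj (.inl v) (.inr (e, l)) ↔
        ((v = G.edgeSrc e ∧ (l : ℕ) = 0) ∨ (v = G.edgeTgt e ∧ (l : ℕ) = k)) := by
        simp [polygonGraph, PolygonAdj]
      rw [← ite_and, ← ite_and, ← ite_or_eq_add]
      · exact if_congr this rfl rfl
      · rintro ⟨⟨h1, -⟩, h2, -⟩
        exact hne (h1 ▸ h2)
    rw [Finset.sum_congr rfl fun l _ => hval l, Finset.sum_add_distrib]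
    congr 1
    · split_ifs with h
      · rw [Fin.sum_ite_val_eq]
        simp
      · simp
    · split_ifs with h
      · rw [Fin.sum_ite_val_eq, dif_pos (by omega)]
        rfl
      · simp

theorem polygonGraph_sum_neighborFinset_inr (g : V ⊕ (G.edgeSet × Fin (k + 1)) → ℝ)
    (e : G.edgeSet) (j : Fin (k + 1)) :
    ∑ w ∈ (G.polygonGraph (k + 2)).neighborFinset (.inr (e, j)), g w =
      G.pathValue (n := k + 2) g e j + G.pathValue (n := k + 2) g e (j + 2) := by
  classical
  rw [sum_neighborFinset_eq_sum_ite, Fintype.sum_sum_type, Fintype.sum_prod_type]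
  have hne := G.edgeSrc_ne_edgeTgt e
  have h1 : ∀ u : V, (if (G.polygonGraph (k + 2)).Adj (.inr (e, j)) (.inl u)
      then g (.inl u) else 0) =
      (if u = G.edgeSrc e then (if (j : ℕ) = 0 then g (.inl u) else 0) else 0) +
      (if u = G.edgeTgt e then (if (j : ℕ) = k then g (.inl u) else 0) else 0) := by
    intro u
    have : (G.polygonGraph (k + 2)).Adj (.inr (e, j)) (.inl u) ↔
        ((u = G.edgeSrc e ∧ (j : ℕ) = 0) ∨ (u = G.edgeTgt e ∧ (j : ℕ) = k)) := by
      simp [polygonGraph, PolygonAdj]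
    rw [← ite_and, ← ite_and, ← ite_or_eq_add]
    · exact if_congr this rfl rfl
    · rintro ⟨⟨h1, -⟩, h2, -⟩
      exact hne (h1 ▸ h2)
  have h2 : ∀ (f : G.edgeSet) (l : Fin (k + 2 - 1)),
      (if (G.polygonGraph (k + 2)).Adj (.inr (e, j)) (.inr (f, l))
      then g (.inr (f, l)) else 0) =
      if e = f then ((if (l : ℕ) = j + 1 then g (.inr (f, l)) else 0) +
        (if (j : ℕ) ≠ 0 then (if (l : ℕ) = j - 1 then g (.inr (f, l)) else 0) else 0)) else 0 := by
    intro f l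
    -- The guard `j ≠ 0` is needed because `j - 1` is truncated: at `j = 0` the predecessor is an
    -- old vertex.
    have : (G.polygonGraph (k + 2)).Adj (.inr (e, j)) (.inr (f, l)) ↔
        e = f ∧ ((l : ℕ) = j + 1 ∨ ((j : ℕ) ≠ 0 ∧ (l : ℕ) = j - 1)) := by
      simp only [polygonGraph, PolygonAdj]
      refine and_congr_right fun _ => ?_
      omega
    rw [← ite_and, ← ite_or_eq_add, ← ite_and]
    · exact if_congr this rfl rfl
    · omega
  rw [Finset.sum_congr rfl fun u _ => h1 u, Finset.sum_add_distrib, Finset.sum_ite_eq',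
    Finset.sum_ite_eq', if_pos (Finset.mem_univ _), if_pos (Finset.mem_univ _),
    Finset.sum_congr rfl fun f _ => Finset.sum_congr rfl fun l _ => h2 f l]
  rw [Finset.sum_eq_single e (fun f _ hf => by simp [hf.symm]) (by simp)]
  simp only [if_true]
  rw [Finset.sum_add_distrib]
  have h4 : (∑ l : Fin (k + 2 - 1), if (l : ℕ) = j + 1 then g (.inr (e, l)) else 0) =
      if h : (j + 1 : ℕ) < k + 2 - 1 then g (.inr (e, ⟨j + 1, h⟩)) else 0 :=
    Fin.sum_ite_val_eq (N := k + 2 - 1) (j + 1 : ℕ) fun l => g (.inr (e, l))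
  have h3 : (∑ l : Fin (k + 2 - 1), if (j : ℕ) ≠ 0 then
      (if (l : ℕ) = j - 1 then g (.inr (e, l)) else 0) else 0) =
      if (j : ℕ) ≠ 0 then g (.inr (e, ⟨j - 1, by omega⟩)) else 0 := by
    split_ifs with h
    · exact (Fin.sum_ite_val_eq (N := k + 2 - 1) ((j : ℕ) - 1) fun l => g (.inr (e, l))).trans
        (dif_pos (by omega))
    · simp
  rw [h3, h4]
  have hj := j.2
  simp only [pathValue]
  -- The cases record whether the predecessor is the source and whether the successor is the target;
  -- both hold when `k = 0`.
  by_cases hj0 : (j : ℕ) = 0 <;> by_cases hjk : (j : ℕ) = k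
  · have a1 : ¬ (j + 1 : ℕ) < k + 2 - 1 := by omega
    have a2 : ¬ (j + 2 - 1 : ℕ) < k + 2 - 1 := by omega
    rw [if_pos hj0, if_pos hjk, dif_neg a1, if_neg (not_not.2 hj0), if_pos hj0,
      if_neg (by omega), dif_neg a2]
    ring
  · have a1 : (j + 1 : ℕ) < k + 2 - 1 := by omega
    have a2 : (j + 2 - 1 : ℕ) < k + 2 - 1 := by omega
    rw [if_pos hj0, if_neg hjk, dif_pos a1, if_neg (not_not.2 hj0), if_pos hj0,
      if_neg (by omega), dif_pos a2]
    simp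
  · have a1 : ¬ (j + 1 : ℕ) < k + 2 - 1 := by omega
    have a2 : ¬ (j + 2 - 1 : ℕ) < k + 2 - 1 := by omega
    have a3 : (j - 1 : ℕ) < k + 2 - 1 := by omega
    rw [if_neg hj0, if_pos hjk, dif_neg a1, if_pos hj0, if_neg hj0, dif_pos a3,
      if_neg (by omega), dif_neg a2]
    ring
  · have a1 : (j + 1 : ℕ) < k + 2 - 1 := by omega
    have a2 : (j + 2 - 1 : ℕ) < k + 2 - 1 := by omega
    have a3 : (j - 1 : ℕ) < k + 2 - 1 := by omega
    rw [if_neg hj0, if_neg hjk, dif_pos a1, if_pos hj0, if_neg hj0, dif_pos a3,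
      if_neg (by omega), dif_pos a2]
    rw [add_zero, zero_add]
    exact add_comm (G := ℝ) _ _

theorem degree_eq_sum_neighborFinset {W : Type*} [Fintype W] (H : SimpleGraph W)
    [DecidableRel H.Adj] (v : W) : (H.degree v : ℝ) = ∑ _u ∈ H.neighborFinset v, (1 : ℝ) := by
  simp

theorem polygonGraph_degree_inl (v : V) :
    ((G.polygonGraph (k + 2)).degree (.inl v) : ℝ) = 2 * G.degree v := by
  rw [degree_eq_sum_neighborFinset]
  refine (G.polygonGraph_sum_neighborFinset_inl k (fun _ => 1) v).trans ?_
  rw [G.sum_edges_eq_sum_neighborFinset (fun _ _ => 1) v, ← degree_eq_sum_neighborFinset]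
  ring

theorem polygonGraph_degree_inr (e : G.edgeSet) (j : Fin (k + 1)) :
    ((G.polygonGraph (k + 2)).degree (.inr (e, j)) : ℝ) = 2 := by
  rw [degree_eq_sum_neighborFinset]
  refine (G.polygonGraph_sum_neighborFinset_inr k (fun _ => 1) e j).trans ?_
  simp only [pathValue, ite_self, dite_eq_ite]
  norm_num

theorem polygonGraph_degree_pos (hdeg : ∀ v, 0 < G.degree v)
    (w : V ⊕ (G.edgeSet × Fin (k + 1))) : 0 < (G.polygonGraph (k + 2)).degree w := by
  rw [← Nat.cast_pos (α := ℝ)]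
  rcases w with v | ⟨e, j⟩
  · rw [polygonGraph_degree_inl]
    have : (0 : ℝ) < G.degree v := Nat.cast_pos.2 (hdeg v)
    linarith
  · rw [polygonGraph_degree_inr]
    norm_num

/-! ### Solving the recursion along the new paths -/

/-- The conditions on the values `h` at the old vertices and `x` at the first inner vertices of
the new paths under which they extend to an eigenfunction of the walk on the polygon graph. -/
noncomputable def polygonData (μ : ℝ) : Submodule ℝ ((V → ℝ) × (G.edgeSet → ℝ)) where
  carrier := {p | (∀ e, p.1 (G.edgeTgt e) =
      p.2 e * polySeqAux μ (k + 2) - p.1 (G.edgeSrc e) * polySeqAux μ (k + 1)) ∧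
    ∀ v, 2 * (1 - μ) * G.degree v * p.1 v = ∑ u ∈ G.neighborFinset v, p.1 u +
      ∑ e : G.edgeSet, ((if v = G.edgeSrc e then p.2 e else 0) +
        (if v = G.edgeTgt e then
          p.2 e * polySeqAux μ (k + 1) - p.1 (G.edgeSrc e) * polySeqAux μ k else 0))}
  add_mem' := by
    rintro p q ⟨hp1, hp2⟩ ⟨hq1, hq2⟩
    refine ⟨fun e => ?_, fun v => ?_⟩
    · simp only [Prod.fst_add, Prod.snd_add, Pi.add_apply, hp1, hq1]
      ring
    · simp only [Prod.fst_add, Prod.snd_add, Pi.add_apply]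
      rw [mul_add, hp2, hq2, add_add_add_comm]
      refine congrArg₂ _ Finset.sum_add_distrib.symm ?_
      rw [← Finset.sum_add_distrib]
      refine Finset.sum_congr rfl fun e _ => ?_
      split_ifs <;> ring
  zero_mem' := by simp
  smul_mem' := by
    rintro a p ⟨hp1, hp2⟩
    refine ⟨fun e => ?_, fun v => ?_⟩
    · simp only [Prod.smul_fst, Prod.smul_snd, Pi.smul_apply, smul_eq_mul, hp1]
      ring
    · simp only [Prod.smul_fst, Prod.smul_snd, Pi.smul_apply, smul_eq_mul]
      rw [mul_left_comm, hp2, ← Finset.mul_sum, mul_add]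
      congr 1
      rw [Finset.mul_sum]
      refine Finset.sum_congr rfl fun e _ => ?_
      split_ifs <;> ring

/-- The extension of data on the old and the first inner vertices by the recursion along the new
paths. -/
noncomputable def polygonExtend (μ : ℝ) :
    ((V → ℝ) × (G.edgeSet → ℝ)) →ₗ[ℝ] (V ⊕ (G.edgeSet × Fin (k + 1)) → ℝ) where
  toFun p := Sum.elim p.1 fun q =>
    p.2 q.1 * polySeqAux μ (q.2 + 1) - p.1 (G.edgeSrc q.1) * polySeqAux μ q.2
  map_add' p q := by
    ext (v | ⟨e, j⟩)
    · simp
    · simp only [Prod.fst_add, Prod.snd_add, Pi.add_apply, Sum.elim_inr]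
      ring
  map_smul' a p := by
    ext (v | ⟨e, j⟩)
    · simp
    · simp only [Prod.smul_fst, Prod.smul_snd, Pi.smul_apply, smul_eq_mul, Sum.elim_inr,
        RingHom.id_apply]
      ring

theorem polygonExtend_inl (μ : ℝ) (p : (V → ℝ) × (G.edgeSet → ℝ)) (v : V) :
    G.polygonExtend k μ p (.inl v) = p.1 v := rfl

theorem polygonExtend_inr (μ : ℝ) (p : (V → ℝ) × (G.edgeSet → ℝ)) (e : G.edgeSet)
    (j : Fin (k + 1)) : G.polygonExtend k μ p (.inr (e, j)) =
      p.2 e * polySeqAux μ (j + 1) - p.1 (G.edgeSrc e) * polySeqAux μ j := rfl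

theorem polygonExtend_inr_zero (μ : ℝ) (p : (V → ℝ) × (G.edgeSet → ℝ)) (e : G.edgeSet) :
    G.polygonExtend k μ p (.inr (e, 0)) = p.2 e := by
  simp [polygonExtend_inr, polySeqAux]

theorem polygonExtend_injective (μ : ℝ) : Function.Injective (G.polygonExtend k μ) := by
  intro p q h
  refine Prod.ext (funext fun v => ?_) (funext fun e => ?_)
  · simpa only [polygonExtend_inl] using congrFun h (.inl v)
  · simpa only [polygonExtend_inr_zero] using congrFun h (.inr (e, 0))

variable {G k}

theorem pathValue_zero (g : V ⊕ (G.edgeSet × Fin (k + 1)) → ℝ) (e : G.edgeSet) :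
    G.pathValue (n := k + 2) g e 0 = g (.inl (G.edgeSrc e)) := by
  simp [pathValue]

theorem pathValue_succ (g : V ⊕ (G.edgeSet × Fin (k + 1)) → ℝ) (e : G.edgeSet)
    (j : Fin (k + 1)) : G.pathValue (n := k + 2) g e (j + 1) = g (.inr (e, j)) := by
  have hj : (j : ℕ) < k + 2 - 1 := j.2
  simp only [pathValue, Nat.add_eq_zero_iff, one_ne_zero, and_false, if_false,
    Nat.add_sub_cancel, dif_pos hj]
  rfl

theorem pathValue_last (g : V ⊕ (G.edgeSet × Fin (k + 1)) → ℝ) (e : G.edgeSet) :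
    G.pathValue (n := k + 2) g e (k + 2) = g (.inl (G.edgeTgt e)) := by
  simp [pathValue]

theorem mem_walkEigenspace_polygonGraph_iff {μ : ℝ} {g : V ⊕ (G.edgeSet × Fin (k + 1)) → ℝ} :
    g ∈ (G.polygonGraph (k + 2)).walkEigenspace μ ↔
      (∀ v, 2 * (1 - μ) * G.degree v * g (.inl v) = ∑ u ∈ G.neighborFinset v, g (.inl u) +
        ∑ e : G.edgeSet, ((if v = G.edgeSrc e then g (.inr (e, 0)) else 0) +
          (if v = G.edgeTgt e then g (.inr (e, Fin.last k)) else 0))) ∧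
      ∀ e, ∀ j ≤ k, G.pathValue (n := k + 2) g e (j + 2) =
        2 * (1 - μ) * G.pathValue (n := k + 2) g e (j + 1) - G.pathValue (n := k + 2) g e j := by
  have hinl : ∀ v, ((1 - μ) * (G.polygonGraph (k + 2)).degree (.inl v) * g (.inl v) =
      ∑ w ∈ (G.polygonGraph (k + 2)).neighborFinset (.inl v), g w) ↔
      (2 * (1 - μ) * G.degree v * g (.inl v) = ∑ u ∈ G.neighborFinset v, g (.inl u) +
        ∑ e : G.edgeSet, ((if v = G.edgeSrc e then g (.inr (e, 0)) else 0) +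
          (if v = G.edgeTgt e then g (.inr (e, Fin.last k)) else 0))) := by
    intro v
    rw [polygonGraph_degree_inl]
    refine Eq.congr (by ring) (G.polygonGraph_sum_neighborFinset_inl k g v)
  have hinr : ∀ (e : G.edgeSet) (j : Fin (k + 1)),
      ((1 - μ) * (G.polygonGraph (k + 2)).degree (.inr (e, j)) * g (.inr (e, j)) =
      ∑ w ∈ (G.polygonGraph (k + 2)).neighborFinset (.inr (e, j)), g w) ↔
      G.pathValue (n := k + 2) g e (j + 2) =
        2 * (1 - μ) * G.pathValue (n := k + 2) g e (j + 1) -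
          G.pathValue (n := k + 2) g e j := by
    intro e j
    rw [G.polygonGraph_sum_neighborFinset_inr k g e j, polygonGraph_degree_inr, pathValue_succ]
    constructor <;> intro h <;> linarith
  constructor
  · intro hg
    exact ⟨fun v => (hinl v).1 (hg (.inl v)),
      fun e j hj => (hinr e ⟨j, by omega⟩).1 (hg (.inr (e, ⟨j, by omega⟩)))⟩
  · rintro ⟨h1, h2⟩ (v | ⟨e, j⟩)
    · exact (hinl v).2 (h1 v)
    · exact (hinr e j).2 (h2 e j (by omega))

theorem pathValue_polygonExtend {μ : ℝ} (p : (V → ℝ) × (G.edgeSet → ℝ)) (e : G.edgeSet)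
    {j : ℕ} (hj : j ≤ k) : G.pathValue (n := k + 2) (G.polygonExtend k μ p) e (j + 1) =
      p.2 e * polySeqAux μ (j + 1) - p.1 (G.edgeSrc e) * polySeqAux μ j :=
  pathValue_succ _ e ⟨j, by omega⟩

theorem polygonExtend_mem_iff {μ : ℝ} {p : (V → ℝ) × (G.edgeSet → ℝ)} :
    G.polygonExtend k μ p ∈ (G.polygonGraph (k + 2)).walkEigenspace μ ↔
      p ∈ G.polygonData k μ := by
  have hpath : ∀ e, (∀ j ≤ k, G.pathValue (n := k + 2) (G.polygonExtend k μ p) e (j + 2) =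
      2 * (1 - μ) * G.pathValue (n := k + 2) (G.polygonExtend k μ p) e (j + 1) -
        G.pathValue (n := k + 2) (G.polygonExtend k μ p) e j) ↔
      p.1 (G.edgeTgt e) =
        p.2 e * polySeqAux μ (k + 2) - p.1 (G.edgeSrc e) * polySeqAux μ (k + 1) := by
    intro e
    have hprev : ∀ j ≤ k, 2 * (1 - μ) *
        G.pathValue (n := k + 2) (G.polygonExtend k μ p) e (j + 1) -
        G.pathValue (n := k + 2) (G.polygonExtend k μ p) e j =
        p.2 e * polySeqAux μ (j + 2) - p.1 (G.edgeSrc e) * polySeqAux μ (j + 1) := by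
      intro j hj
      rw [pathValue_polygonExtend p e hj]
      -- The closed form holds from position `1` on; position `0` would need the term before
      -- `polySeqAux μ 0`, so it is treated apart.
      rcases j with _ | j
      · rw [pathValue_zero, polygonExtend_inl]
        simp [polySeqAux]
        ring
      · rw [pathValue_polygonExtend p e (by omega), polySeqAux_add_two μ (j + 1),
          polySeqAux_add_two μ j]
        ring
    constructor
    · intro h
      have := h k le_rfl
      rwa [hprev k le_rfl, pathValue_last, polygonExtend_inl] at this
    · intro h j hj
      rw [hprev j hj]
      rcases hj.eq_or_lt with rfl | hj
      · rw [pathValue_last, polygonExtend_inl, h]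
      · exact pathValue_polygonExtend p e hj
  rw [mem_walkEigenspace_polygonGraph_iff, forall_congr' hpath, and_comm]
  have h0 : ∀ e, p.2 e * polySeqAux μ ((0 : Fin (k + 1)) + 1 : ℕ) -
      p.1 (G.edgeSrc e) * polySeqAux μ ((0 : Fin (k + 1)) : ℕ) = p.2 e := by
    simp [polySeqAux]
  simp only [polygonExtend_inl, polygonExtend_inr, Fin.val_last, h0]
  rfl

theorem map_polygonExtend_polygonData (μ : ℝ) :
    (G.polygonData k μ).map (G.polygonExtend k μ) =
      (G.polygonGraph (k + 2)).walkEigenspace μ := by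
  ext g
  rw [Submodule.mem_map]
  constructor
  · rintro ⟨p, hp, rfl⟩
    exact polygonExtend_mem_iff.2 hp
  · intro hg
    -- A solution of the second-order recursion is recovered from its values at the source and at
    -- the first inner vertex.
    have hext : G.polygonExtend k μ (fun v => g (.inl v), fun e => g (.inr (e, 0))) = g := by
      have h2 := (mem_walkEigenspace_polygonGraph_iff.1 hg).2
      funext w
      rcases w with v | ⟨e, j⟩
      · rfl
      rw [polygonExtend_inr]
      have key : ∀ j ≤ k, G.pathValue (n := k + 2) g e (j + 1) =
          g (.inr (e, 0)) * polySeqAux μ (j + 1) -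
            g (.inl (G.edgeSrc e)) * polySeqAux μ j := by
        intro j
        induction j using Nat.twoStepInduction with
        | zero =>
          intro _
          rw [show (0 : ℕ) + 1 = ((0 : Fin (k + 1)) : ℕ) + 1 by simp, pathValue_succ]
          simp [polySeqAux]
        | one =>
          intro hj
          have h0 : G.pathValue (n := k + 2) g e 1 = g (.inr (e, 0)) :=
            pathValue_succ g e 0
          rw [h2 e 0 (by omega), pathValue_zero, h0]
          simp [polySeqAux]
          ring
        | more j ih1 ih2 =>
          intro hj
          rw [h2 e (j + 1) (by omega), ih1 (by omega), ih2 (by omega),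
            polySeqAux_add_two μ (j + 1), polySeqAux_add_two μ j]
          ring
      rw [← pathValue_succ g e j, key j (by omega)]
    exact ⟨_, polygonExtend_mem_iff.1 (hext.symm ▸ hg), hext⟩

theorem polygonGraph_normLapMult_eq_finrank (hdeg : ∀ v, 0 < G.degree v) (μ : ℝ) :
    (G.polygonGraph (k + 2)).normLapMult μ = Module.finrank ℝ (G.polygonData k μ) := by
  rw [normLapMult_eq_finrank _ (G.polygonGraph_degree_pos k hdeg), ← map_polygonExtend_polygonData]
  exact (Submodule.equivMapOfInjective _ (G.polygonExtend_injective k μ) _).finrank_eq.symm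

end SimpleGraph

/-! ### Dimension of the solution space -/

namespace SimpleGraph

variable {V : Type*} [Fintype V] [DecidableEq V] (G : SimpleGraph V) [DecidableRel G.Adj]

/-- The functions on the vertices which satisfy `a d(v) h(v) = b ∑_{u ∼ v} h(u)`. -/
def weightedEigenspace (a b : ℝ) : Submodule ℝ (V → ℝ) where
  carrier := {h | ∀ v, a * (G.degree v * h v) = b * ∑ u ∈ G.neighborFinset v, h u}
  add_mem' := by
    intro f g hf hg v
    simp only [Pi.add_apply, Finset.sum_add_distrib, mul_add, ← hf v, ← hg v]
  zero_mem' := by simp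
  smul_mem' := by
    intro c g hg v
    simp only [Pi.smul_apply, smul_eq_mul, ← Finset.mul_sum]
    rw [mul_left_comm b, ← hg v]
    ring

variable {G}

theorem weightedEigenspace_zero_zero : G.weightedEigenspace 0 0 = ⊤ := by
  rw [eq_top_iff]
  intro h _ v
  simp

theorem weightedEigenspace_zero_right (hdeg : ∀ v, 0 < G.degree v) {a : ℝ} (ha : a ≠ 0) :
    G.weightedEigenspace a 0 = ⊥ := by
  rw [Submodule.eq_bot_iff]
  intro h hh
  funext v
  have := hh v
  simpa [ha, (hdeg v).ne'] using this

theorem weightedEigenspace_mul_left {c : ℝ} (hc : c ≠ 0) (a b : ℝ) :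
    G.weightedEigenspace (c * a) (c * b) = G.weightedEigenspace a b := by
  ext h
  refine forall_congr' fun v => ?_
  rw [mul_assoc, mul_assoc, mul_right_inj' hc]

theorem weightedEigenspace_eq_walkEigenspace {a b : ℝ} (hb : b ≠ 0) :
    G.weightedEigenspace a b = G.walkEigenspace (1 - a / b) := by
  ext h
  refine forall_congr' fun v => ?_
  rw [sub_sub_cancel, mul_assoc, div_mul_eq_mul_div, div_eq_iff hb, mul_comm b]

/-- The matching condition can be solved for `x`, so projection to `h` is injective on the data. The
two coefficients are kept undivided because either may vanish. -/
theorem finrank_polygonData_of_ne_zero {k : ℕ} {μ : ℝ} (hA : polySeqAux μ (k + 2) ≠ 0) :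
    Module.finrank ℝ (G.polygonData k μ) =
      Module.finrank ℝ
        (G.weightedEigenspace (polySeqAux μ (k + 3)) (polySeqAux μ (k + 2) + 1)) := by
  set A := polySeqAux μ (k + 2) with hAdef
  set B := polySeqAux μ (k + 1) with hBdef
  let T : (V → ℝ) →ₗ[ℝ] (V → ℝ) × (G.edgeSet → ℝ) :=
    { toFun := fun h => (h, fun e => (h (G.edgeTgt e) + h (G.edgeSrc e) * B) / A)
      map_add' := by
        intro f g
        refine Prod.ext rfl (funext fun e => ?_)
        simp only [Pi.add_apply, Prod.snd_add]
        ring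
      map_smul' := by
        intro c f
        refine Prod.ext rfl (funext fun e => ?_)
        simp only [Pi.smul_apply, Prod.smul_snd, smul_eq_mul, RingHom.id_apply]
        ring }
  have hT : Function.Injective T := fun f g h => congrArg Prod.fst h
  have hcas := polySeqAux_cassini μ k
  have hrec := polySeqAux_add_two μ (k + 1)
  rw [← hAdef, ← hBdef] at hcas
  rw [show k + 1 + 2 = k + 3 by ring, show k + 1 + 1 = k + 2 by ring, ← hAdef, ← hBdef] at hrec
  have hmem : ∀ h : V → ℝ, T h ∈ G.polygonData k μ ↔
      h ∈ G.weightedEigenspace (polySeqAux μ (k + 3)) (A + 1) := by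
    intro h
    have h1 : ∀ e, (T h).1 (G.edgeTgt e) = (T h).2 e * A - (T h).1 (G.edgeSrc e) * B := by
      intro e
      change h _ = (h (G.edgeTgt e) + h (G.edgeSrc e) * B) / A * A - h _ * B
      rw [div_mul_cancel₀ _ hA]
      ring
    have h2 : ∀ v, ∑ e : G.edgeSet, ((if v = G.edgeSrc e then (T h).2 e else 0) +
        (if v = G.edgeTgt e then
          (T h).2 e * B - (T h).1 (G.edgeSrc e) * polySeqAux μ k else 0)) =
        (∑ u ∈ G.neighborFinset v, h u + G.degree v * h v * B) / A := by
      intro v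
      have hsum := G.sum_edges_eq_sum_neighborFinset (fun a b => (h b + h a * B) / A) v
      have hN : ∑ u ∈ G.neighborFinset v, (h u + h v * B) / A =
          (∑ u ∈ G.neighborFinset v, h u + G.degree v * h v * B) / A := by
        rw [← Finset.sum_div, Finset.sum_add_distrib, Finset.sum_const,
          card_neighborFinset_eq_degree, nsmul_eq_mul, ← mul_assoc]
      rw [← hN, ← hsum]
      refine Finset.sum_congr rfl fun e _ => ?_
      congr 1
      refine if_congr Iff.rfl ?_ rfl
      -- By the Cassini identity the value at the last inner vertex is the one at the first with the
      -- ends of `e` exchanged.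
      change (h (G.edgeTgt e) + h (G.edgeSrc e) * B) / A * B - h (G.edgeSrc e) * _ = _
      field_simp
      linear_combination h (G.edgeSrc e) * hcas
    have : T h ∈ G.polygonData k μ ↔ ∀ v, 2 * (1 - μ) * G.degree v * h v =
        ∑ u ∈ G.neighborFinset v, h u +
          (∑ u ∈ G.neighborFinset v, h u + G.degree v * h v * B) / A := by
      constructor
      · intro H v
        rw [← h2 v]
        exact H.2 v
      · intro H
        refine ⟨h1, fun v => ?_⟩
        rw [h2 v]
        exact H v
    rw [this]
    refine forall_congr' fun v => ?_
    rw [← sub_eq_iff_eq_add', eq_div_iff hA, hrec]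
    constructor <;> intro H <;> linear_combination H
  have : G.polygonData k μ =
      (G.weightedEigenspace (polySeqAux μ (k + 3)) (A + 1)).map T := by
    ext p
    rw [Submodule.mem_map]
    constructor
    · intro hp
      have hpT : T p.1 = p := by
        refine Prod.ext rfl (funext fun e => ?_)
        change (p.1 (G.edgeTgt e) + p.1 (G.edgeSrc e) * B) / A = p.2 e
        rw [div_eq_iff hA, hp.1 e]
        ring
      exact ⟨p.1, (hmem _).1 (hpT.symm ▸ hp), hpT⟩
    · rintro ⟨h, hh, rfl⟩
      exact (hmem h).2 hh
  rw [this]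
  exact (Submodule.equivMapOfInjective _ hT _).finrank_eq.symm

/-- The incidence matrix of `G` with entry `1` at the source and `-s` at the target of an edge. -/
noncomputable def twistedIncMatrix (G : SimpleGraph V) (s : ℝ) : Matrix V G.edgeSet ℝ :=
  fun v e => (if v = G.edgeSrc e then 1 else 0) - if v = G.edgeTgt e then s else 0

/-- Rank-nullity for the matrix and for its transpose, whose kernel is the twist space, combined
with equality of the two ranks. -/
theorem finrank_ker_twistedIncMatrix (G : SimpleGraph V) [DecidableRel G.Adj] (s : ℝ) :
    Module.finrank ℝ (LinearMap.ker (Matrix.toLin' (G.twistedIncMatrix s))) + Fintype.card V =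
      G.edgeFinset.card + Module.finrank ℝ (G.edgeTwistSpace s) := by
  have h1 := LinearMap.finrank_range_add_finrank_ker (Matrix.toLin' (G.twistedIncMatrix s))
  have h2 := LinearMap.finrank_range_add_finrank_ker
    (Matrix.toLin' (G.twistedIncMatrix s).transpose)
  have h3 := (G.twistedIncMatrix s).rank_transpose
  have hker : LinearMap.ker (Matrix.toLin' (G.twistedIncMatrix s).transpose) =
      G.edgeTwistSpace s := by
    ext h
    rw [LinearMap.mem_ker, funext_iff]
    refine forall_congr' fun e => ?_
    rw [← sub_eq_zero (a := h (G.edgeSrc e))]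
    simp [Matrix.toLin'_apply, Matrix.mulVec, dotProduct, twistedIncMatrix, sub_mul]
  rw [hker] at h2
  rw [Matrix.rank, Matrix.rank, ← Matrix.toLin'_apply', ← Matrix.toLin'_apply'] at h3
  rw [Module.finrank_fintype_fun_eq_card] at h1 h2
  rw [edgeFinset_card]
  omega

/-- The matching condition reduces to `h (tgt) = s h (src)`. Pairing the vertex equations with `h`
then cancels `x` and leaves `(1 - μ - s) Q = 0`, where `Q` is the sum of `h (src) ^ 2` over the
edges and `1 - μ ≠ s`. -/
theorem eq_zero_of_mem_polygonData (hdeg : ∀ v, 0 < G.degree v) {k : ℕ} {μ s : ℝ}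
    (hs : s ^ 2 = 1) (hA : polySeqAux μ (k + 2) = 0) (hB : polySeqAux μ (k + 1) = -s)
    {p : (V → ℝ) × (G.edgeSet → ℝ)} (hp : p ∈ G.polygonData k μ) : p.1 = 0 := by
  obtain ⟨h, x⟩ := p
  obtain ⟨hp1, hp2⟩ := hp
  -- The recursion run backwards from the values at `k + 2` and `k + 1`.
  have hC : polySeqAux μ k = -2 * (1 - μ) * s := by
    have := polySeqAux_add_two μ k
    rw [hA, hB] at this
    linarith
  simp only [hA, hB, hC] at hp1 hp2
  have htgt : ∀ e, h (G.edgeTgt e) = s * h (G.edgeSrc e) := fun e => by rw [hp1]; ring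
  set Q := ∑ e : G.edgeSet, h (G.edgeSrc e) ^ 2 with hQ
  have e1 : ∑ v, G.degree v * h v ^ 2 = 2 * Q := by
    have := G.sum_sum_neighborFinset_eq_sum_edges fun v _ => h v ^ 2
    simp only [Finset.sum_const, card_neighborFinset_eq_degree, nsmul_eq_mul] at this
    rw [this, hQ, Finset.mul_sum]
    refine Finset.sum_congr rfl fun e _ => ?_
    rw [htgt]
    linear_combination h (G.edgeSrc e) ^ 2 * hs
  have e2 : ∑ v, h v * ∑ u ∈ G.neighborFinset v, h u = 2 * s * Q := by
    have := G.sum_sum_neighborFinset_eq_sum_edges fun v u => h v * h u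
    simp only [← Finset.mul_sum] at this
    rw [this, hQ, Finset.mul_sum]
    refine Finset.sum_congr rfl fun e _ => ?_
    rw [htgt]
    ring
  have e3 : ∑ v, h v * ∑ e : G.edgeSet, ((if v = G.edgeSrc e then x e else 0) +
        (if v = G.edgeTgt e then
          x e * -s - h (G.edgeSrc e) * (-2 * (1 - μ) * s) else 0)) = 2 * (1 - μ) * Q := by
    simp only [Finset.mul_sum]
    rw [Finset.sum_comm, hQ, Finset.mul_sum]
    refine Finset.sum_congr rfl fun e _ => ?_
    simp only [mul_add, mul_ite, mul_zero, Finset.sum_add_distrib, Finset.sum_ite_eq',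
      Finset.mem_univ, if_true]
    rw [htgt]
    linear_combination
      (-h (G.edgeSrc e) * x e + 2 * (1 - μ) * h (G.edgeSrc e) ^ 2) * hs
  have e4 : 2 * (1 - μ) * (2 * Q) = 2 * s * Q + 2 * (1 - μ) * Q := by
    rw [← e3, ← e2, ← e1, ← Finset.sum_add_distrib, Finset.mul_sum]
    refine Finset.sum_congr rfl fun v _ => ?_
    rw [← mul_add, ← hp2 v]
    ring
  have hQ0 : Q = 0 := by
    have h1 := ne_of_polySeqAux_eq_zero (by omega) hA hs
    have h2 : (1 - μ - s) * Q = 0 := by linarith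
    exact (mul_eq_zero.1 h2).resolve_left (sub_ne_zero.2 h1)
  funext v
  rw [hQ0, mul_zero] at e1
  have := (Finset.sum_eq_zero_iff_of_nonneg (fun v _ => by positivity)).1 e1 v (Finset.mem_univ _)
  simpa [(hdeg v).ne'] using this

/-- All eigenfunctions vanish on the old vertices, and the vertex equations for `x` alone say that
the twisted incidence matrix kills it. -/
theorem finrank_polygonData_of_eq_zero (hdeg : ∀ v, 0 < G.degree v) {k : ℕ} {μ s : ℝ}
    (hs : s ^ 2 = 1) (hA : polySeqAux μ (k + 2) = 0) (hB : polySeqAux μ (k + 1) = -s) :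
    Module.finrank ℝ (G.polygonData k μ) + Fintype.card V =
      G.edgeFinset.card + Module.finrank ℝ (G.edgeTwistSpace s) := by
  rw [← finrank_ker_twistedIncMatrix]
  congr 1
  have hker : ∀ x : G.edgeSet → ℝ, x ∈ LinearMap.ker (Matrix.toLin' (G.twistedIncMatrix s)) ↔
      ∀ v, ∑ e : G.edgeSet, ((if v = G.edgeSrc e then x e else 0) +
        (if v = G.edgeTgt e then x e * -s else 0)) = 0 := by
    intro x
    rw [LinearMap.mem_ker, funext_iff]
    refine forall_congr' fun v => ?_
    refine Eq.congr (Finset.sum_congr rfl fun e _ => ?_) rfl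
    simp only [twistedIncMatrix]
    split_ifs <;> ring
  have : G.polygonData k μ =
      (LinearMap.ker (Matrix.toLin' (G.twistedIncMatrix s))).map
        (LinearMap.inr ℝ (V → ℝ) (G.edgeSet → ℝ)) := by
    ext p
    rw [Submodule.mem_map]
    constructor
    · intro hp
      have h0 := eq_zero_of_mem_polygonData hdeg hs hA hB hp
      obtain ⟨h, x⟩ := p
      obtain rfl : h = 0 := h0
      refine ⟨x, (hker x).2 fun v => ?_, rfl⟩
      have := hp.2 v
      simp only [hB, Pi.zero_apply, mul_zero, zero_mul, sub_zero, Finset.sum_const_zero,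
        zero_add] at this
      exact this.symm
    · rintro ⟨x, hx, rfl⟩
      refine ⟨fun e => ?_, fun v => ?_⟩
      · simp [hA]
      · have := (hker x).1 hx v
        simp only [LinearMap.inr_apply, hB, Pi.zero_apply, mul_zero, zero_mul, sub_zero,
          Finset.sum_const_zero, zero_add]
        exact this.symm
  rw [this]
  exact (Submodule.equivMapOfInjective _ LinearMap.inr_injective _).finrank_eq.symm

end SimpleGraph

/-! ### Multiplicities for even `n`, with `n = 2 * t + 2` -/

namespace SimpleGraph

variable {V : Type*} [Fintype V] [DecidableEq V] {G : SimpleGraph V} [DecidableRel G.Adj]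
variable {μ : ℝ} {t : ℕ}

/-- The factorization of `polySeqAux μ (2 * t + 2) + 1` forces the value `-1`. -/
theorem polySeqAux_ne_zero_of_sum_eq_zero
    (h : polySeqAux μ (t + 2) + polySeqAux μ (t + 1) = 0) : polySeqAux μ (2 * t + 2) ≠ 0 := by
  have := polySeqAux_two_mul_add_one_eq_mul μ t
  rw [h, zero_mul] at this
  linarith

/-- The multiplicity of a root of `a_m + a_{m-1}` in the polygon graph. -/
theorem polygonGraph_normLapMult_of_sum_eq_zero (hdeg : ∀ v, 0 < G.degree v)
    (h : polySeqAux μ (t + 2) + polySeqAux μ (t + 1) = 0) :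
    (G.polygonGraph (2 * t + 2)).normLapMult μ = Fintype.card V := by
  rw [polygonGraph_normLapMult_eq_finrank hdeg,
    finrank_polygonData_of_ne_zero (polySeqAux_ne_zero_of_sum_eq_zero h),
    polySeqAux_two_mul_add_three, polySeqAux_two_mul_add_one_eq_mul, h, zero_mul, zero_mul,
    weightedEigenspace_zero_zero, finrank_top, Module.finrank_fintype_fun_eq_card]

theorem polygonGraph_normLapMult_of_sum_ne_zero (hdeg : ∀ v, 0 < G.degree v)
    (hA : polySeqAux μ (2 * t + 2) ≠ 0)
    (h : polySeqAux μ (t + 2) + polySeqAux μ (t + 1) ≠ 0) :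
    (G.polygonGraph (2 * t + 2)).normLapMult μ =
      Module.finrank ℝ (G.weightedEigenspace (polySeqAux μ (t + 2) - polySeqAux μ (t + 1))
        (polySeqAux μ (t + 1) - polySeqAux μ t)) := by
  rw [polygonGraph_normLapMult_eq_finrank hdeg, finrank_polygonData_of_ne_zero hA,
    polySeqAux_two_mul_add_three, polySeqAux_two_mul_add_one_eq_mul,
    weightedEigenspace_mul_left h]

/-- The generic case: the multiplicity is inherited from the base graph. -/
theorem polygonGraph_normLapMult_eq_normLapMult (hdeg : ∀ v, 0 < G.degree v)
    (hA : polySeqAux μ (2 * t + 2) ≠ 0)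
    (h : polySeqAux μ (t + 2) + polySeqAux μ (t + 1) ≠ 0)
    (hq : polySeqAux μ (t + 1) - polySeqAux μ t ≠ 0) :
    (G.polygonGraph (2 * t + 2)).normLapMult μ =
      G.normLapMult (1 - (polySeqAux μ (t + 2) - polySeqAux μ (t + 1)) /
        (polySeqAux μ (t + 1) - polySeqAux μ t)) := by
  rw [polygonGraph_normLapMult_of_sum_ne_zero hdeg hA h,
    weightedEigenspace_eq_walkEigenspace hq, normLapMult_eq_finrank G hdeg]

/-- Two consecutive differences of the sequence do not vanish together. -/
theorem not_polySeqAux_sub_eq_zero_and (μ : ℝ) (t : ℕ) :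
    ¬ (polySeqAux μ (t + 2) - polySeqAux μ (t + 1) = 0 ∧
      polySeqAux μ (t + 1) - polySeqAux μ t = 0) := by
  rintro ⟨h1, h2⟩
  have h3 := polySeqAux_cassini μ t
  rw [sub_eq_zero.1 h1, ← sub_eq_zero.1 h2] at h3
  linarith

theorem polygonGraph_normLapMult_eq_zero (hdeg : ∀ v, 0 < G.degree v)
    (hA : polySeqAux μ (2 * t + 2) ≠ 0)
    (h : polySeqAux μ (t + 2) + polySeqAux μ (t + 1) ≠ 0)
    (hq : polySeqAux μ (t + 1) - polySeqAux μ t = 0) :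
    (G.polygonGraph (2 * t + 2)).normLapMult μ = 0 := by
  have hp : polySeqAux μ (t + 2) - polySeqAux μ (t + 1) ≠ 0 := fun hp =>
    not_polySeqAux_sub_eq_zero_and μ t ⟨hp, hq⟩
  rw [polygonGraph_normLapMult_of_sum_ne_zero hdeg hA h, hq,
    weightedEigenspace_zero_right hdeg hp, finrank_bot]

theorem normLapMult_zero (hG : G.Connected) (hdeg : ∀ v, 0 < G.degree v) :
    G.normLapMult 0 = 1 := by
  rw [normLapMult_eq_finrank G hdeg, walkEigenspace_zero, finrank_edgeTwistSpace_one hG]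

/-- At `μ = 0` the sequence is `k ↦ k`, so the quotient is `1` and the corresponding `λ` is `0`. -/
theorem polygonGraph_normLapMult_zero (hG : G.Connected) (hdeg : ∀ v, 0 < G.degree v) :
    (G.polygonGraph (2 * t + 2)).normLapMult 0 = 1 := by
  rw [polygonGraph_normLapMult_eq_normLapMult hdeg]
  · simp only [polySeqAux_at_zero]
    push_cast
    rw [show (1 : ℝ) - (t + 2 - (t + 1)) / (t + 1 - t) = 0 by
      rw [show (t : ℝ) + 2 - (t + 1) = 1 by ring, show (t : ℝ) + 1 - t = 1 by ring]; norm_num]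
    exact normLapMult_zero hG hdeg
  all_goals
    simp only [polySeqAux_at_zero]
    push_cast
  · positivity
  · positivity
  · rw [show (t : ℝ) + 1 - t = 1 by ring]; norm_num

/-- Here the Cassini identity gives `polySeqAux μ (2 * t + 1) = -1`, which is the sign `s = 1`. -/
theorem polygonGraph_normLapMult_of_eq_zero (hdeg : ∀ v, 0 < G.degree v)
    (h : polySeqAux μ (t + 1) = 0) :
    (G.polygonGraph (2 * t + 2)).normLapMult μ + Fintype.card V =
      G.edgeFinset.card + Module.finrank ℝ (G.edgeTwistSpace 1) := by
  have hc := polySeqAux_cassini μ t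
  have hr := polySeqAux_add_two μ t
  rw [h] at hc hr
  rw [polygonGraph_normLapMult_eq_finrank hdeg]
  refine finrank_polygonData_of_eq_zero hdeg (by norm_num) ?_ ?_
  · rw [polySeqAux_two_mul, h, zero_mul]
  · rw [polySeqAux_two_mul_add_one, h]
    rw [hr] at hc
    linarith

/-- Here the Cassini identity gives `polySeqAux μ (2 * t + 1) = 1`, which is the sign `s = -1`. -/
theorem polygonGraph_normLapMult_of_sub_eq_zero (hdeg : ∀ v, 0 < G.degree v)
    (h : polySeqAux μ (t + 2) - polySeqAux μ t = 0) :
    (G.polygonGraph (2 * t + 2)).normLapMult μ + Fintype.card V =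
      G.edgeFinset.card + Module.finrank ℝ (G.edgeTwistSpace (-1)) := by
  have hc := polySeqAux_cassini μ t
  rw [polygonGraph_normLapMult_eq_finrank hdeg]
  refine finrank_polygonData_of_eq_zero hdeg (by norm_num) ?_ ?_
  · rw [polySeqAux_two_mul, h, mul_zero]
  · rw [polySeqAux_two_mul_add_one]
    rw [sub_eq_zero.1 h] at hc
    linarith

theorem polySeqAux_quotient_eq_one (hp : polySeqAux μ (t + 2) - polySeqAux μ (t + 1) =
    polySeqAux μ (t + 1) - polySeqAux μ t) : μ = 0 ∨ polySeqAux μ (t + 1) = 0 := by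
  have hr := polySeqAux_add_two μ t
  rw [← mul_eq_zero]
  linear_combination (-1 / 2) * hp + (1 / 2) * hr

/-- The roots belonging to an eigenvalue strictly between `0` and `2` are not roots of
`a_m + a_{m-1}`. -/
theorem polySeqAux_sum_ne_zero {r : ℝ} (hr : |r| < 1)
    (hp : polySeqAux μ (t + 2) - polySeqAux μ (t + 1) =
      r * (polySeqAux μ (t + 1) - polySeqAux μ t)) :
    polySeqAux μ (t + 2) + polySeqAux μ (t + 1) ≠ 0 := by
  intro h
  obtain ⟨hr1, hr2⟩ := abs_lt.1 hr
  have hc := polySeqAux_cassini μ t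
  have hrec := polySeqAux_add_two μ t
  set a := polySeqAux μ (t + 2)
  have hb : polySeqAux μ (t + 1) = -a := by linarith
  have h0 : polySeqAux μ t = -(2 * (1 - μ) * a) - a := by rw [hb] at hrec; linarith
  -- The Cassini identity in terms of `a` alone; it yields `μ < 2`.
  have hca : 2 * a ^ 2 * (2 - μ) = 1 := by
    rw [hb, h0] at hc
    linear_combination hc
  have ha : a ≠ 0 := by
    rintro ha
    rw [ha] at hca
    norm_num at hca
  have hμ2 : μ < 2 := by
    have : 0 < a ^ 2 := by positivity
    by_contra! hle
    nlinarith
  have hrc : r * (1 - μ) = 1 := by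
    have : (2 * a) * (r * (1 - μ) - 1) = 0 := by
      rw [hb, h0] at hp
      linear_combination -hp
    have := (mul_eq_zero.1 this).resolve_left (by simpa using ha)
    linarith
  -- From `r (1 - μ) = 1` and `|r| < 1` follows `|1 - μ| > 1`, which for `μ < 2` leaves only `μ ≤
  -- 0`. There the sequence is increasing and the sum is positive.
  have hμ : μ ≤ 0 := by
    by_contra! hpos
    have h1 : |r * (1 - μ)| < 1 := by
      rw [abs_mul]
      have : |1 - μ| ≤ 1 := abs_le.2 ⟨by linarith, by linarith⟩
      nlinarith [abs_nonneg r, abs_nonneg (1 - μ)]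
    rw [hrc] at h1
    norm_num at h1
  have h1 := polySeqAux_pos_of_nonpos hμ t
  have h2 := polySeqAux_pos_of_nonpos hμ (t + 1)
  have h3 : polySeqAux μ (t + 1) + 1 ≤ a := h2.2
  linarith [h1.1, h1.2]

theorem IsNormLapEigenvalue.abs_one_sub_lt (hdeg : ∀ v, 0 < G.degree v) {l : ℝ}
    (hl : G.IsNormLapEigenvalue l) (h0 : l ≠ 0) (h2 : l ≠ 2) : |1 - l| < 1 := by
  refine (hl.abs_one_sub_le hdeg).lt_of_ne fun h => ?_
  rcases (abs_eq zero_le_one).1 h with h | h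
  · exact h0 (by linarith)
  · exact h2 (by linarith)

theorem one_sub_quotient_eq_iff {p q l : ℝ} (hq : q ≠ 0) :
    1 - p / q = l ↔ p = (1 - l) * q := by
  rw [← div_eq_iff hq]
  constructor <;> intro h <;> linarith

theorem polygonGraph_normLapMult_of_quotient_eq (hdeg : ∀ v, 0 < G.degree v) {l : ℝ}
    (hl : G.IsNormLapEigenvalue l) (h0 : l ≠ 0) (h2 : l ≠ 2)
    (hq : polySeqAux μ (t + 1) - polySeqAux μ t ≠ 0)
    (h : 1 - (polySeqAux μ (t + 2) - polySeqAux μ (t + 1)) /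
      (polySeqAux μ (t + 1) - polySeqAux μ t) = l) :
    (G.polygonGraph (2 * t + 2)).normLapMult μ = G.normLapMult l := by
  have hp := (one_sub_quotient_eq_iff hq).1 h
  have hsum := polySeqAux_sum_ne_zero (hl.abs_one_sub_lt hdeg h0 h2) hp
  rw [polygonGraph_normLapMult_eq_normLapMult hdeg ?_ hsum hq, h]
  have hrec := polySeqAux_add_two μ t
  rw [polySeqAux_two_mul]
  -- A zero of the first factor would force `l = 0`, a zero of the second `l = 2`.
  refine mul_ne_zero (fun hz => ?_) (fun hz => ?_)
  · have : l * (polySeqAux μ (t + 1) - polySeqAux μ t) = 0 := by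
      rw [hz] at hp hrec ⊢
      linear_combination hp - hrec
    exact (mul_ne_zero h0 hq) this
  · have : (2 - l) * (polySeqAux μ (t + 1) - polySeqAux μ t) = 0 := by
      linear_combination hz - hp
    exact (mul_ne_zero (sub_ne_zero.2 h2.symm) hq) this

theorem ncard_quotient_eq {l : ℝ} (hl : |1 - l| < 1) (t : ℕ) :
    {x : ℝ | polySeqAux x (t + 1) - polySeqAux x t ≠ 0 ∧
      1 - (polySeqAux x (t + 2) - polySeqAux x (t + 1)) /
        (polySeqAux x (t + 1) - polySeqAux x t) = l}.ncard = t + 1 := by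
  refine Eq.trans (congrArg Set.ncard ?_) (ncard_polySeqAux_roots hl t)
  ext x
  constructor
  · rintro ⟨hq, h⟩
    exact (one_sub_quotient_eq_iff hq).1 h
  · intro h
    -- A root of the cleared equation with zero denominator would have zero numerator as well, so
    -- clearing denominators adds no roots.
    have hq : polySeqAux x (t + 1) - polySeqAux x t ≠ 0 := by
      intro hq
      refine not_polySeqAux_sub_eq_zero_and x t ⟨?_, hq⟩
      rw [Set.mem_ofPred_eq, hq, mul_zero] at h
      exact h
    exact ⟨hq, (one_sub_quotient_eq_iff hq).2 h⟩

/-- Every eigenvalue of the polygon graph is exceptional or comes from an eigenvalue of the base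
graph. -/
theorem polygonGraph_eigenvalue_cases (hdeg : ∀ v, 0 < G.degree v)
    (hμ : (G.polygonGraph (2 * t + 2)).IsNormLapEigenvalue μ) :
    μ = 0 ∨ polySeqAux μ (t + 2) + polySeqAux μ (t + 1) = 0 ∨ polySeqAux μ (t + 1) = 0 ∨
      polySeqAux μ (t + 2) - polySeqAux μ t = 0 ∨
      ∃ l : ℝ, G.IsNormLapEigenvalue l ∧ l ≠ 0 ∧ l ≠ 2 ∧
        polySeqAux μ (t + 1) - polySeqAux μ t ≠ 0 ∧
        1 - (polySeqAux μ (t + 2) - polySeqAux μ (t + 1)) /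
          (polySeqAux μ (t + 1) - polySeqAux μ t) = l := by
  rw [isNormLapEigenvalue_iff_normLapMult_pos] at hμ
  by_cases h0 : μ = 0
  · exact Or.inl h0
  by_cases h1 : polySeqAux μ (t + 2) + polySeqAux μ (t + 1) = 0
  · exact Or.inr (Or.inl h1)
  by_cases h2 : polySeqAux μ (t + 1) = 0
  · exact Or.inr (Or.inr (Or.inl h2))
  by_cases h3 : polySeqAux μ (t + 2) - polySeqAux μ t = 0
  · exact Or.inr (Or.inr (Or.inr (Or.inl h3)))
  have hA : polySeqAux μ (2 * t + 2) ≠ 0 := by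
    rw [polySeqAux_two_mul]
    exact mul_ne_zero h2 h3
  have hq : polySeqAux μ (t + 1) - polySeqAux μ t ≠ 0 := by
    intro hq
    rw [polygonGraph_normLapMult_eq_zero hdeg hA h1 hq] at hμ
    exact hμ.false
  rw [polygonGraph_normLapMult_eq_normLapMult hdeg hA h1 hq] at hμ
  refine Or.inr (Or.inr (Or.inr (Or.inr ⟨_, (G.isNormLapEigenvalue_iff_normLapMult_pos _).2 hμ,
    fun h => ?_, fun h => ?_, hq, rfl⟩)))
  -- The value `λ = 0` would give `μ = 0` or a root of `a_{m-1}`; in the next case `λ = 2` would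
  -- give `a_m = a_{m-2}`. All of these are already excluded.
  · have hp := (one_sub_quotient_eq_iff hq).1 h
    rw [sub_zero, one_mul] at hp
    rcases polySeqAux_quotient_eq_one hp with h | h
    · exact h0 h
    · exact h2 h
  · have hp := (one_sub_quotient_eq_iff hq).1 h
    exact h3 (by linear_combination hp)

end SimpleGraph

theorem theorem2 {V : Type*} [Fintype V] [DecidableEq V] [Nontrivial V]
    (G : SimpleGraph V) [DecidableRel G.Adj] (hG : G.Connected)
    (n : ℕ) (hn : 2 ≤ n) (hn_even : Even n) :
    -- (i) `0` is a simple eigenvalue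
    (G.polygonGraph n).normLapMult 0 = 1 ∧
    -- (ii) roots of `a_{n/2} + a_{n/2-1}`
    (∀ μ : ℝ, polySeq ((n : ℤ) / 2) μ + polySeq ((n : ℤ) / 2 - 1) μ = 0 →
      (G.polygonGraph n).normLapMult μ = Fintype.card V) ∧
    -- (iii) roots of `a_{n/2-1}`
    (∀ μ : ℝ, polySeq ((n : ℤ) / 2 - 1) μ = 0 →
      ((G.polygonGraph n).normLapMult μ : ℤ) = (G.edgeFinset.card : ℤ) - Fintype.card V + 1) ∧
    -- (iv) roots of `a_{n/2} - a_{n/2-2}`, non-bipartite case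
    (¬ G.IsBipartite → ∀ μ : ℝ, polySeq ((n : ℤ) / 2) μ - polySeq ((n : ℤ) / 2 - 2) μ = 0 →
      ((G.polygonGraph n).normLapMult μ : ℤ) = (G.edgeFinset.card : ℤ) - Fintype.card V) ∧
    -- (v) roots of `a_{n/2} - a_{n/2-2}`, bipartite case
    (G.IsBipartite → ∀ μ : ℝ, polySeq ((n : ℤ) / 2) μ - polySeq ((n : ℤ) / 2 - 2) μ = 0 →
      ((G.polygonGraph n).normLapMult μ : ℤ) = (G.edgeFinset.card : ℤ) - Fintype.card V + 1) ∧
    -- (vi) every eigenvalue `λ ∉ {0, 2}` of `G` yields exactly `n / 2` eigenvalues, with the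
    -- same multiplicity
    (∀ l : ℝ, G.IsNormLapEigenvalue l → l ≠ 0 → l ≠ 2 →
      {x : ℝ | polySeq ((n : ℤ) / 2 - 1) x - polySeq ((n : ℤ) / 2 - 2) x ≠ 0 ∧
        1 - (polySeq ((n : ℤ) / 2) x - polySeq ((n : ℤ) / 2 - 1) x) /
          (polySeq ((n : ℤ) / 2 - 1) x - polySeq ((n : ℤ) / 2 - 2) x) = l}.ncard = n / 2 ∧
      ∀ μ : ℝ, polySeq ((n : ℤ) / 2 - 1) μ - polySeq ((n : ℤ) / 2 - 2) μ ≠ 0 →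
        1 - (polySeq ((n : ℤ) / 2) μ - polySeq ((n : ℤ) / 2 - 1) μ) /
          (polySeq ((n : ℤ) / 2 - 1) μ - polySeq ((n : ℤ) / 2 - 2) μ) = l →
        (G.polygonGraph n).IsNormLapEigenvalue μ ∧
        (G.polygonGraph n).normLapMult μ = G.normLapMult l) ∧
    -- the list is complete
    (∀ μ : ℝ, (G.polygonGraph n).IsNormLapEigenvalue μ →
      μ = 0 ∨
      polySeq ((n : ℤ) / 2) μ + polySeq ((n : ℤ) / 2 - 1) μ = 0 ∨
      polySeq ((n : ℤ) / 2 - 1) μ = 0 ∨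
      polySeq ((n : ℤ) / 2) μ - polySeq ((n : ℤ) / 2 - 2) μ = 0 ∨
      ∃ l : ℝ, G.IsNormLapEigenvalue l ∧ l ≠ 0 ∧ l ≠ 2 ∧
        polySeq ((n : ℤ) / 2 - 1) μ - polySeq ((n : ℤ) / 2 - 2) μ ≠ 0 ∧
        1 - (polySeq ((n : ℤ) / 2) μ - polySeq ((n : ℤ) / 2 - 1) μ) /
          (polySeq ((n : ℤ) / 2 - 1) μ - polySeq ((n : ℤ) / 2 - 2) μ) = l) := by
  -- With `t = n / 2 - 1`, the terms `a_{n/2}`, `a_{n/2-1}`, `a_{n/2-2}` have indices `t + 2`, `t +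
  -- 1`, `t` in `polySeqAux`.
  obtain ⟨t, rfl⟩ : ∃ t, n = 2 * t + 2 := by
    obtain ⟨m, rfl⟩ := hn_even
    exact ⟨m - 1, by omega⟩
  have hdeg : ∀ v, 0 < G.degree v := fun v => hG.preconnected.degree_pos_of_nontrivial v
  have h1 : ∀ μ, polySeq (((2 * t + 2 : ℕ) : ℤ) / 2) μ = polySeqAux μ (t + 2) := by
    intro μ
    rw [polySeq, show (((2 * t + 2 : ℕ) : ℤ) / 2 + 1).toNat = t + 2 by omega]
  have h2 : ∀ μ, polySeq (((2 * t + 2 : ℕ) : ℤ) / 2 - 1) μ = polySeqAux μ (t + 1) := by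
    intro μ
    rw [polySeq, show (((2 * t + 2 : ℕ) : ℤ) / 2 - 1 + 1).toNat = t + 1 by omega]
  have h3 : ∀ μ, polySeq (((2 * t + 2 : ℕ) : ℤ) / 2 - 2) μ = polySeqAux μ t := by
    intro μ
    rw [polySeq, show (((2 * t + 2 : ℕ) : ℤ) / 2 - 2 + 1).toNat = t by omega]
  simp only [h1, h2, h3]
  refine ⟨SimpleGraph.polygonGraph_normLapMult_zero hG hdeg,
    fun μ h => SimpleGraph.polygonGraph_normLapMult_of_sum_eq_zero hdeg h,
    fun μ h => ?_, fun hb μ h => ?_, fun hb μ h => ?_, fun l hl hl0 hl2 => ⟨?_, fun μ hq h => ?_⟩,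
    fun μ h => SimpleGraph.polygonGraph_eigenvalue_cases hdeg h⟩
  · have := SimpleGraph.polygonGraph_normLapMult_of_eq_zero hdeg h
    rw [SimpleGraph.finrank_edgeTwistSpace_one hG] at this
    omega
  · have := SimpleGraph.polygonGraph_normLapMult_of_sub_eq_zero hdeg h
    rw [SimpleGraph.finrank_edgeTwistSpace_neg_one_of_not_isBipartite hG hb] at this
    omega
  · have := SimpleGraph.polygonGraph_normLapMult_of_sub_eq_zero hdeg h
    rw [SimpleGraph.finrank_edgeTwistSpace_neg_one_of_isBipartite hG hb] at this
    omega
  · rw [SimpleGraph.ncard_quotient_eq (hl.abs_one_sub_lt hdeg hl0 hl2)]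
    omega
  · have hm := SimpleGraph.polygonGraph_normLapMult_of_quotient_eq hdeg hl hl0 hl2 hq h
    refine ⟨?_, hm⟩
    rw [SimpleGraph.isNormLapEigenvalue_iff_normLapMult_pos, hm]
    exact (G.isNormLapEigenvalue_iff_normLapMult_pos l).1 hl
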